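/- Let $n\ge 1$ and let $(\mathcal C,\mathbb E,\mathfrak s)$ be an $n$-exangulated category in the sense of Herschend–Liu–Nakaoka: $\mathcal C$ is an additive category, $\mathbb E:\mathcal C^{op}\times\mathcal C\to \mathrm{Ab}$ is an additive bifunctor, and $\mathfrak s$ is an exact realization of $\mathbb E$ satisfying the axioms (EA1), (EA2), (EA2$^{op}$). A *distinguished $n$-exangle* $\langle X^\bullet,\delta\rangle$ is a complex $X^0\xrightarrow{d^0}X^1\to\cdots\to X^n\xrightarrow{d^n}X^{n+1}$ together with $\delta\in\mathbb E(X^{n+1},X^0)$ such that $X^\bullet$ lies in the homotopy class $\mathfrak s(\delta)$; a morphism $\langle X^\bullet,\delta\rangle\to\langle Y^\bullet,\rho\rangle$ is a chain map $f$ with $(f^0)_*\delta=(f^{n+1})^*\rho$. The *contravariant defect* $\widetilde\delta$ and the *covariant defect* $\check\delta$ are defined by exact sequences of functors $$\mathcal C(-,X^n)\to\mathcal C(-,X^{n+1})\to\widetilde\delta\to0,\qquad \mathcal C(X^1,-)\to\mathcal C(X^0,-)\to\check\delta\to0 .$$ An object $P$ is *projective* if for every distinguished $n$-exangle each morphism $P\to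 X^{n+1}$ factors through $d^n$; an object $I$ is *injective* if for every distinguished $n$-exangle each morphism $X^0\to I$ factors through $d^0$. There are *enough projectives* if every object is the last term $X^{n+1}$ of a distinguished $n$-exangle with $X^1,\dots,X^n$ projective, and *enough injectives* if every object is the first term $X^0$ of a distinguished $n$-exangle with $X^1,\dots,X^n$ injective. Let $\underline{\mathcal C}$ (resp. $\overline{\mathcal C}$) be the quotient of $\mathcal C$ by the ideal of morphisms factoring through a projective (resp. injective) object. For an additive category $\mathcal A$, let $\mathrm{mod}\,\mathcal A$ be the category of finitely presented contravariant functors $\mathcal A\to\mathrm{Ab}$, that is, of cokernels of morphisms $\mathcal A(-,X)\to\mathcal A(-,Y)$; objects of $\mathrm{mod}\,\underline{\mathcal C}$ and of $\mathrm{mod}(\overline{\mathcal C}^{op})$ are identified with functors on $\mathcal C$ by composing with the quotient functors. **Proposition.** Suppose that $\mathcal C$ has enough projectives and enough injectives. Then there is a duality (a contravariant equivalence of categories) $$\Sigma:\mathrm{mod}\,\underline{\mathcal C}\longrightarrow\mathrm{mod}(\overline{\mathcal C}^{op})$$ such that for every distinguished $n$-exangle $\langle X^\bullet,\delta\rangle$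 one has $\widetilde\delta\in\mathrm{mod}\,\underline{\mathcal C}$ and $\Sigma(\widetilde\delta)\cong\check\delta$, naturally with respect to morphisms of distinguished $n$-exangles. Moreover, for every object $X$ of $\mathcal C$: 1. $\Sigma(\underline{\mathcal C}(-,X))\cong\mathbb E(X,-)$; 2. $\mathbb E(-,X)$ lies in $\mathrm{mod}\,\underline{\mathcal C}$ and $\Sigma(\mathbb E(-,X))\cong\overline{\mathcal C}(X,-)$. -/

import Mathlib

open CategoryTheory CategoryTheory.Limits Opposite

universe v u

/-! ### Quotients of additive categories by ideals of morphisms -/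

section IdealQuotient

variable {C : Type u} [Category.{v} C] [Preadditive C] [HasBinaryBiproducts C]

/-- The class of objects `Q` contains the zero objects and is closed under direct sums. -/
class ClosedUnderSums (Q : ObjectProperty C) : Prop where
  zero : ∃ Z : C, IsZero Z ∧ Q Z
  sum : ∀ P R : C, Q P → Q R → Q (P ⊞ R)

/-- Two parallel morphisms are related when their difference factors through an object in `Q`. -/
def idealRel (Q : ObjectProperty C) : HomRel C := fun X Y f g =>
  ∃ (P : C) (_ : Q P) (a : X ⟶ P) (b : P ⟶ Y), a ≫ b = f - g

lemma idealRel_add (Q : ObjectProperty C) [ClosedUnderSums Q] {X Y : C} (f₁ f₂ g₁ g₂ : X ⟶ Y)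
    (h₁ : idealRel Q f₁ f₂) (h₂ : idealRel Q g₁ g₂) : idealRel Q (f₁ + g₁) (f₂ + g₂) := by
  obtain ⟨P, hP, a, b, h⟩ := h₁
  obtain ⟨R, hR, c, d, k⟩ := h₂
  refine ⟨P ⊞ R, ClosedUnderSums.sum P R hP hR, biprod.lift a c, biprod.desc b d, ?_⟩
  rw [biprod.lift_desc, h, k]
  abel

instance idealRel_congruence (Q : ObjectProperty C) [ClosedUnderSums Q] :
    Congruence (idealRel Q) where
  comp_left := by
    rintro X Y Z f g₁ g₂ ⟨P, hP, a, b, h⟩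
    exact ⟨P, hP, f ≫ a, b, by rw [Category.assoc, h, Preadditive.comp_sub]⟩
  comp_right := by
    rintro X Y Z f₁ f₂ g ⟨P, hP, a, b, h⟩
    exact ⟨P, hP, a, b ≫ g, by rw [← Category.assoc, h, Preadditive.sub_comp]⟩
  equivalence :=
    { refl := fun f => by
        obtain ⟨Z, _, hZ⟩ := ClosedUnderSums.zero (Q := Q)
        exact ⟨Z, hZ, 0, 0, by simp⟩
      symm := by
        rintro f g ⟨P, hP, a, b, h⟩
        exact ⟨P, hP, -a, b, by rw [Preadditive.neg_comp, h, neg_sub]⟩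
      trans := by
        rintro f g k ⟨P, hP, a, b, h⟩ ⟨R, hR, c, d, e⟩
        refine ⟨P ⊞ R, ClosedUnderSums.sum P R hP hR, biprod.lift a c, biprod.desc b d, ?_⟩
        rw [biprod.lift_desc, h, e]
        abel }

/-- The quotient category `C/[Q]`: same objects as `C`, morphisms modulo those that factor
through an object in `Q`. -/
abbrev IdealQuotient (Q : ObjectProperty C) := CategoryTheory.Quotient (idealRel Q)

instance idealQuotient_preadditive (Q : ObjectProperty C) [ClosedUnderSums Q] :
    Preadditive (IdealQuotient Q) :=
  CategoryTheory.Quotient.preadditive (idealRel Q) (fun _ _ => idealRel_add Q)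

end IdealQuotient

/-! ### Finitely presented modules over an additive category -/

section Modules

variable (A : Type u) [Category.{v} A] [Preadditive A]

/-- A contravariant functor `F` to abelian groups is finitely presented if there is an exact
sequence `A(-,X) → A(-,Y) → F → 0`. -/
def finPresRight : ObjectProperty (Aᵒᵖ ⥤ AddCommGrpCat.{v}) := fun F =>
  ∃ (X Y : A) (f : X ⟶ Y), Nonempty (cokernel (preadditiveYoneda.map f) ≅ F)

/-- A covariant functor `F` to abelian groups is finitely presented if there is an exact
sequence `A(Y,-) → A(X,-) → F → 0`. -/
def finPresLeft : ObjectProperty (A ⥤ AddCommGrpCat.{v}) := fun F =>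
  ∃ (X Y : A) (f : X ⟶ Y), Nonempty (cokernel (preadditiveCoyoneda.map f.op) ≅ F)

/-- `mod A`: the category of finitely presented contravariant functors from `A` to abelian
groups. -/
abbrev ModRight := (finPresRight A).FullSubcategory

/-- `mod (Aᵒᵖ)`: the category of finitely presented covariant functors from `A` to abelian
groups. -/
abbrev ModLeft := (finPresLeft A).FullSubcategory

variable {A}

/-- The representable functor `A(-,X)` as an object of `mod A`. -/
noncomputable def reprRight (X : A) : ModRight A :=
  ⟨preadditiveYoneda.obj X, X, X, 0,
    ⟨cokernelIsoOfEq (by ext; exact comp_zero) ≪≫ cokernelZeroIsoTarget⟩⟩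

/-- The representable functor `A(X,-)` as an object of `mod (Aᵒᵖ)`. -/
noncomputable def reprLeft (X : A) : ModLeft A :=
  ⟨preadditiveCoyoneda.obj (op X), X, X, 0,
    ⟨cokernelIsoOfEq (by ext; exact zero_comp) ≪≫ cokernelZeroIsoTarget⟩⟩

end Modules

/-! ### Complexes with `n + 2` terms and given end terms -/

section Complexes

variable {C : Type u} [Category.{v} C] [Preadditive C]

/-- A complex `X⁰ ⟶ X¹ ⟶ ⋯ ⟶ Xⁿ⁺¹` (zero in degrees above `n + 1`) whose end terms `X⁰` and
`Xⁿ⁺¹` are identified with `A` and `B`. -/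
structure EndComplex (n : ℕ) (A B : C) where
  K : CochainComplex C ℕ
  isZero : ∀ i : ℕ, n + 1 < i → IsZero (K.X i)
  left : K.X 0 ≅ A
  right : K.X (n + 1) ≅ B

namespace EndComplex

variable {n : ℕ} {A B : C}

/-- The first differential, `A ⟶ X¹`. -/
def first (X : EndComplex n A B) : A ⟶ X.K.X 1 := X.left.inv ≫ X.K.d 0 1

/-- The last differential, `Xⁿ ⟶ B`. -/
def last (X : EndComplex n A B) : X.K.X n ⟶ B := X.K.d n (n + 1) ≫ X.right.hom

/-- The component in degree `0` of a chain map. -/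
def leftMap {A₁ B₁ A₂ B₂ : C} (X : EndComplex n A₁ B₁) (Y : EndComplex n A₂ B₂)
    (f : X.K ⟶ Y.K) : A₁ ⟶ A₂ := X.left.inv ≫ f.f 0 ≫ Y.left.hom

/-- The component in degree `n + 1` of a chain map. -/
def rightMap {A₁ B₁ A₂ B₂ : C} (X : EndComplex n A₁ B₁) (Y : EndComplex n A₂ B₂)
    (f : X.K ⟶ Y.K) : B₁ ⟶ B₂ := X.right.inv ≫ f.f (n + 1) ≫ Y.right.hom

/-- Homotopy equivalence of complexes with end terms `A` and `B`: the chain maps in both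
directions are identities on `A` and on `B`, and the homotopies are arbitrary. -/
def HomotopyEquivalent (X Y : EndComplex n A B) : Prop :=
  ∃ (f : X.K ⟶ Y.K) (g : Y.K ⟶ X.K),
    leftMap X Y f = 𝟙 A ∧ rightMap X Y f = 𝟙 B ∧
    leftMap Y X g = 𝟙 A ∧ rightMap Y X g = 𝟙 B ∧
    Nonempty (Homotopy (f ≫ g) (𝟙 X.K)) ∧ Nonempty (Homotopy (g ≫ f) (𝟙 Y.K))

variable [HasBinaryBiproducts C]

/-- `M` is the mapping cone
`X¹ ⟶ X² ⊞ Y¹ ⟶ ⋯ ⟶ Xⁿ⁺¹ ⊞ Yⁿ ⟶ Yⁿ⁺¹ = D`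
of a chain map `f : X ⟶ Y` which is the identity in degree `0`. The differentials are
`(-d, f)`, then `(x, y) ↦ (-d x, f x + d y)`, and finally `(x, y) ↦ f x + d y`. -/
def IsMappingCone {A B D : C} (X : EndComplex n A B) (Y : EndComplex n A D) (f : X.K ⟶ Y.K)
    (M : EndComplex n (X.K.X 1) D) : Prop :=
  ∃ e : ∀ i : ℕ, 1 ≤ i → i ≤ n → (M.K.X i ≅ X.K.X (i + 1) ⊞ Y.K.X i),
    (∀ h : 1 ≤ n, M.first ≫ (e 1 le_rfl h).hom = biprod.lift (-X.K.d 1 2) (f.f 1)) ∧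
    (∀ (i : ℕ) (h : 1 ≤ i) (k : i + 1 ≤ n),
      M.K.d i (i + 1) ≫ (e (i + 1) (Nat.le_add_left 1 i) k).hom =
        (e i h ((Nat.le_succ i).trans k)).hom ≫
          biprod.desc (biprod.lift (-X.K.d (i + 1) (i + 2)) (f.f (i + 1)))
            (biprod.lift 0 (Y.K.d i (i + 1)))) ∧
    (∀ h : 1 ≤ n,
      M.last = (e n h le_rfl).hom ≫ biprod.desc (f.f (n + 1) ≫ Y.right.hom) Y.last)

/-- `N` is the mapping cocone
`A = X⁰ ⟶ X¹ ⊞ Y⁰ ⟶ ⋯ ⟶ Xⁿ ⊞ Yⁿ⁻¹ ⟶ Yⁿ`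
of a chain map `f : X ⟶ Y` which is the identity in degree `n + 1`. The differentials are
`(d, f)`, then `(x, y) ↦ (d x, f x - d y)`, and finally `(x, y) ↦ f x - d y`; this is the
mapping cone of `f` in the opposite category. -/
def IsMappingCocone {A B D : C} (X : EndComplex n A B) (Y : EndComplex n D B) (f : X.K ⟶ Y.K)
    (N : EndComplex n A (Y.K.X n)) : Prop :=
  ∃ e : ∀ i : ℕ, i + 1 ≤ n → (N.K.X (i + 1) ≅ X.K.X (i + 1) ⊞ Y.K.X i),
    (∀ h : 0 + 1 ≤ n, N.first ≫ (e 0 h).hom = biprod.lift X.first (X.left.inv ≫ f.f 0)) ∧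
    (∀ (i : ℕ) (k : i + 1 + 1 ≤ n),
      N.K.d (i + 1) (i + 2) ≫ (e (i + 1) k).hom =
        (e i ((Nat.le_succ (i + 1)).trans k)).hom ≫
          biprod.desc (biprod.lift (X.K.d (i + 1) (i + 2)) (f.f (i + 1)))
            (biprod.lift 0 (-Y.K.d i (i + 1)))) ∧
    (∀ (m : ℕ) (h : m + 1 = n),
      N.K.d (m + 1) (n + 1) ≫ N.right.hom =
        (e m h.le).hom ≫ biprod.desc (f.f (m + 1)) (-Y.K.d m (m + 1)) ≫
          eqToHom (congrArg Y.K.X h))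

end EndComplex

end Complexes

/-! ### Bifunctors of extensions and `n`-exangles -/

section Extensions

variable {C : Type u} [Category.{v} C]

/-- For `δ ∈ E(B, A)` and `a : A ⟶ A₁`, the extension `a_* δ ∈ E(B, A₁)`. -/
def extPush (E : Cᵒᵖ ⥤ C ⥤ AddCommGrpCat.{v}) {A A₁ B : C} (a : A ⟶ A₁)
    (δ : (E.obj (op B)).obj A) : (E.obj (op B)).obj A₁ :=
  ((E.obj (op B)).map a).hom δ

/-- For `δ ∈ E(B, A)` and `c : B₁ ⟶ B`, the extension `c^* δ ∈ E(B₁, A)`. -/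
def extPull (E : Cᵒᵖ ⥤ C ⥤ AddCommGrpCat.{v}) {A B B₁ : C} (c : B₁ ⟶ B)
    (δ : (E.obj (op B)).obj A) : (E.obj (op B₁)).obj A :=
  ((E.map c.op).app A).hom δ

variable [Preadditive C]

/-- The pair of a complex `X` from `A` to `B` and an extension `δ ∈ E(B, A)` is an
`n`-exangle: the sequences of functors
`C(-,X⁰) ⟶ ⋯ ⟶ C(-,Xⁿ⁺¹) ⟶ E(-,X⁰)` and `C(Xⁿ⁺¹,-) ⟶ ⋯ ⟶ C(X⁰,-) ⟶ E(Xⁿ⁺¹,-)` are exact. -/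
structure IsExangle (E : Cᵒᵖ ⥤ C ⥤ AddCommGrpCat.{v}) {n : ℕ} {A B : C}
    (X : EndComplex n A B) (δ : (E.obj (op B)).obj A) : Prop where
  exact_left : ∀ (T : C) (i : ℕ), i < n → ∀ x : T ⟶ X.K.X (i + 1),
    x ≫ X.K.d (i + 1) (i + 2) = 0 → ∃ y : T ⟶ X.K.X i, y ≫ X.K.d i (i + 1) = x
  exact_left_end : ∀ (T : C) (x : T ⟶ B), extPull E x δ = 0 ↔ ∃ y : T ⟶ X.K.X n, y ≫ X.last = x
  exact_right : ∀ (T : C) (i : ℕ), i < n → ∀ x : X.K.X (i + 1) ⟶ T,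
    X.K.d i (i + 1) ≫ x = 0 → ∃ y : X.K.X (i + 2) ⟶ T, X.K.d (i + 1) (i + 2) ≫ y = x
  exact_right_end : ∀ (T : C) (x : A ⟶ T),
    extPush E x δ = 0 ↔ ∃ y : X.K.X 1 ⟶ T, X.first ≫ y = x

end Extensions

/-! ### `n`-exangulated categories -/

/-- An `n`-exangulated structure on an additive category `C`: an additive bifunctor `E` to abelian
groups and an exact realization of `E`, satisfying (EA1), (EA2) and its dual.
`realizes δ X` says that the complex `X` belongs to the homotopy equivalence class assigned
to the extension `δ`. -/
structure NExangulated (C : Type u) [Category.{v} C] [Preadditive C] [HasZeroObject C]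
    [HasBinaryBiproducts C] (n : ℕ) where
  E : Cᵒᵖ ⥤ C ⥤ AddCommGrpCat.{v}
  additive_left : ∀ A : C, (E.flip.obj A).Additive
  additive_right : ∀ B : Cᵒᵖ, (E.obj B).Additive
  realizes : ∀ {A B : C}, (E.obj (op B)).obj A → EndComplex n A B → Prop
  -- every extension is assigned exactly one homotopy equivalence class
  exists_realizes : ∀ {A B : C} (δ : (E.obj (op B)).obj A), ∃ X, realizes δ X
  realizes_iff : ∀ {A B : C} (δ : (E.obj (op B)).obj A) (X Y : EndComplex n A B),
    realizes δ X → (realizes δ Y ↔ X.HomotopyEquivalent Y)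
  -- (R0)
  exists_lift : ∀ {A B A₁ B₁ : C} (δ : (E.obj (op B)).obj A) (ρ : (E.obj (op B₁)).obj A₁)
    (X : EndComplex n A B) (Y : EndComplex n A₁ B₁), realizes δ X → realizes ρ Y →
    ∀ (a : A ⟶ A₁) (c : B ⟶ B₁), extPush E a δ = extPull E c ρ →
      ∃ f : X.K ⟶ Y.K, EndComplex.leftMap X Y f = a ∧ EndComplex.rightMap X Y f = c
  -- (R1)
  isExangle : ∀ {A B : C} (δ : (E.obj (op B)).obj A) (X : EndComplex n A B),
    realizes δ X → IsExangle E X δ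
  -- (R2): `A = A ⟶ 0 ⟶ ⋯ ⟶ 0` realizes `0 ∈ E(0, A)`
  realizes_zero_right : ∀ {A Z : C}, IsZero Z → ∀ X : EndComplex n A Z, IsIso X.first →
    (∀ i : ℕ, 2 ≤ i → IsZero (X.K.X i)) → realizes 0 X
  -- (R2), dually: `0 ⟶ ⋯ ⟶ 0 ⟶ A = A` realizes `0 ∈ E(A, 0)`
  realizes_zero_left : ∀ {Z A : C}, IsZero Z → ∀ X : EndComplex n Z A, IsIso X.last →
    (∀ i : ℕ, i < n → IsZero (X.K.X i)) → realizes 0 X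
  -- (EA1)
  inflation_comp : ∀ {A B D : C} (f : A ⟶ B) (g : B ⟶ D),
    (∃ (P : C) (δ : (E.obj (op P)).obj A) (X : EndComplex n A P) (e : X.K.X 1 ≅ B),
      realizes δ X ∧ X.first ≫ e.hom = f) →
    (∃ (P : C) (δ : (E.obj (op P)).obj B) (X : EndComplex n B P) (e : X.K.X 1 ≅ D),
      realizes δ X ∧ X.first ≫ e.hom = g) →
    ∃ (P : C) (δ : (E.obj (op P)).obj A) (X : EndComplex n A P) (e : X.K.X 1 ≅ D),
      realizes δ X ∧ X.first ≫ e.hom = f ≫ g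
  deflation_comp : ∀ {A B D : C} (f : A ⟶ B) (g : B ⟶ D),
    (∃ (P : C) (δ : (E.obj (op B)).obj P) (X : EndComplex n P B) (e : A ≅ X.K.X n),
      realizes δ X ∧ e.hom ≫ X.last = f) →
    (∃ (P : C) (δ : (E.obj (op D)).obj P) (X : EndComplex n P D) (e : B ≅ X.K.X n),
      realizes δ X ∧ e.hom ≫ X.last = g) →
    ∃ (P : C) (δ : (E.obj (op D)).obj P) (X : EndComplex n P D) (e : A ≅ X.K.X n),
      realizes δ X ∧ e.hom ≫ X.last = f ≫ g
  -- (EA2)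
  exists_good_lift : ∀ {A B D : C} (ρ : (E.obj (op D)).obj A) (c : B ⟶ D)
    (X : EndComplex n A B) (Y : EndComplex n A D),
    realizes (extPull E c ρ) X → realizes ρ Y →
    ∃ (f : X.K ⟶ Y.K) (M : EndComplex n (X.K.X 1) D),
      EndComplex.leftMap X Y f = 𝟙 A ∧ EndComplex.rightMap X Y f = c ∧
      EndComplex.IsMappingCone X Y f M ∧ realizes (extPush E X.first ρ) M
  -- the dual of (EA2)
  exists_good_lift_dual : ∀ {A B D : C} (ρ : (E.obj (op B)).obj A) (a : A ⟶ D)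
    (X : EndComplex n A B) (Y : EndComplex n D B),
    realizes ρ X → realizes (extPush E a ρ) Y →
    ∃ (f : X.K ⟶ Y.K) (N : EndComplex n A (Y.K.X n)),
      EndComplex.leftMap X Y f = a ∧ EndComplex.rightMap X Y f = 𝟙 B ∧
      EndComplex.IsMappingCocone X Y f N ∧ realizes (extPull E Y.last ρ) N

namespace NExangulated

open scoped ZeroObject

variable {C : Type u} [Category.{v} C] [Preadditive C] [HasZeroObject C]
  [HasBinaryBiproducts C] {n : ℕ} (S : NExangulated C n)

/-- Projective objects: morphisms to the last term of a distinguished `n`-exangle lift to the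
last but one term. -/
def proj : ObjectProperty C := fun P =>
  ∀ {A B : C} (δ : (S.E.obj (op B)).obj A) (X : EndComplex n A B), S.realizes δ X →
    ∀ c : P ⟶ B, ∃ b : P ⟶ X.K.X n, b ≫ X.last = c

/-- Injective objects: morphisms from the first term of a distinguished `n`-exangle extend to
the second term. -/
def inj : ObjectProperty C := fun I =>
  ∀ {A B : C} (δ : (S.E.obj (op B)).obj A) (X : EndComplex n A B), S.realizes δ X →
    ∀ a : A ⟶ I, ∃ b : X.K.X 1 ⟶ I, X.first ≫ b = a

/-- Every object `B` is the last term of a distinguished `n`-exangle whose terms in degrees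
`1, …, n` are projective. -/
def EnoughProj : Prop :=
  ∀ B : C, ∃ (A : C) (δ : (S.E.obj (op B)).obj A) (X : EndComplex n A B),
    S.realizes δ X ∧ ∀ i : ℕ, 1 ≤ i → i ≤ n → S.proj (X.K.X i)

/-- Every object `A` is the first term of a distinguished `n`-exangle whose terms in degrees
`1, …, n` are injective. -/
def EnoughInj : Prop :=
  ∀ A : C, ∃ (B : C) (δ : (S.E.obj (op B)).obj A) (X : EndComplex n A B),
    S.realizes δ X ∧ ∀ i : ℕ, 1 ≤ i → i ≤ n → S.inj (X.K.X i)

instance : ClosedUnderSums S.proj where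
  zero := ⟨0, isZero_zero C, fun _ _ _ _ => ⟨0, (isZero_zero C).eq_of_src _ _⟩⟩
  sum P R hP hR := fun δ X hX c => by
    obtain ⟨b, hb⟩ := hP δ X hX (biprod.inl ≫ c)
    obtain ⟨d, hd⟩ := hR δ X hX (biprod.inr ≫ c)
    exact ⟨biprod.desc b d, by ext <;> simp [hb, hd]⟩

instance : ClosedUnderSums S.inj where
  zero := ⟨0, isZero_zero C, fun _ _ _ _ => ⟨0, (isZero_zero C).eq_of_tgt _ _⟩⟩
  sum P R hP hR := fun δ X hX c => by
    obtain ⟨b, hb⟩ := hP δ X hX (c ≫ biprod.fst)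
    obtain ⟨d, hd⟩ := hR δ X hX (c ≫ biprod.snd)
    exact ⟨biprod.lift b d, by ext <;> simp [hb, hd]⟩

/-- The stable category `C/[P]`, where `P` is the class of projective objects. -/
abbrev Stable := IdealQuotient S.proj

/-- The costable category `C/[I]`, where `I` is the class of injective objects. -/
abbrev Costable := IdealQuotient S.inj

/-- The quotient functor from `C` to the stable category. -/
abbrev toStable : C ⥤ S.Stable := CategoryTheory.Quotient.functor (idealRel S.proj)

/-- The quotient functor from `C` to the costable category. -/
abbrev toCostable : C ⥤ S.Costable := CategoryTheory.Quotient.functor (idealRel S.inj)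

/-- A module over the stable category, regarded as a contravariant functor on `C` by composing
with the quotient functor. This is fully faithful. -/
def resStable : ModRight S.Stable ⥤ (Cᵒᵖ ⥤ AddCommGrpCat.{v}) :=
  (finPresRight S.Stable).ι ⋙ (Functor.whiskeringLeft _ _ _).obj S.toStable.op

/-- A module over the opposite of the costable category, regarded as a covariant functor on `C`
by composing with the quotient functor. This is fully faithful. -/
def resCostable : ModLeft S.Costable ⥤ (C ⥤ AddCommGrpCat.{v}) :=
  (finPresLeft S.Costable).ι ⋙ (Functor.whiskeringLeft _ _ _).obj S.toCostable

/-- A distinguished `n`-exangle. -/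
structure DistExangle where
  A : C
  B : C
  δ : (S.E.obj (op B)).obj A
  X : EndComplex n A B
  realizes : S.realizes δ X

namespace DistExangle

variable {S}

/-- A morphism of distinguished `n`-exangles: a chain map `f` with `(f⁰)_* δ = (fⁿ⁺¹)^* ρ`. -/
@[ext]
structure Hom (U V : S.DistExangle) where
  f : U.X.K ⟶ V.X.K
  comm : extPush S.E (EndComplex.leftMap U.X V.X f) U.δ =
    extPull S.E (EndComplex.rightMap U.X V.X f) V.δ

lemma leftMap_id (U : S.DistExangle) : EndComplex.leftMap U.X U.X (𝟙 _) = 𝟙 U.A := by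
  simp [EndComplex.leftMap]

lemma rightMap_id (U : S.DistExangle) : EndComplex.rightMap U.X U.X (𝟙 _) = 𝟙 U.B := by
  simp [EndComplex.rightMap]

lemma leftMap_comp {U V W : S.DistExangle} (f : U.X.K ⟶ V.X.K) (g : V.X.K ⟶ W.X.K) :
    EndComplex.leftMap U.X W.X (f ≫ g) =
      EndComplex.leftMap U.X V.X f ≫ EndComplex.leftMap V.X W.X g := by
  simp [EndComplex.leftMap]

lemma rightMap_comp {U V W : S.DistExangle} (f : U.X.K ⟶ V.X.K) (g : V.X.K ⟶ W.X.K) :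
    EndComplex.rightMap U.X W.X (f ≫ g) =
      EndComplex.rightMap U.X V.X f ≫ EndComplex.rightMap V.X W.X g := by
  simp [EndComplex.rightMap]

lemma last_comm {U V : S.DistExangle} (f : U.X.K ⟶ V.X.K) :
    U.X.last ≫ EndComplex.rightMap U.X V.X f = f.f n ≫ V.X.last := by
  simp [EndComplex.last, EndComplex.rightMap]

lemma first_comm {U V : S.DistExangle} (f : U.X.K ⟶ V.X.K) :
    EndComplex.leftMap U.X V.X f ≫ V.X.first = U.X.first ≫ f.f 1 := by
  simp [EndComplex.first, EndComplex.leftMap]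

instance : Category S.DistExangle where
  Hom := Hom
  id U := ⟨𝟙 _, by rw [leftMap_id, rightMap_id]; simp [extPush, extPull]⟩
  comp {U V W} p q := ⟨p.f ≫ q.f, by
    have h₁ : extPush S.E (EndComplex.leftMap U.X V.X p.f ≫ EndComplex.leftMap V.X W.X q.f) U.δ =
        extPush S.E (EndComplex.leftMap V.X W.X q.f)
          (extPush S.E (EndComplex.leftMap U.X V.X p.f) U.δ) := by
      simp [extPush]
    have h₂ : extPull S.E (EndComplex.rightMap U.X V.X p.f ≫ EndComplex.rightMap V.X W.X q.f) W.δ =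
        extPull S.E (EndComplex.rightMap U.X V.X p.f)
          (extPull S.E (EndComplex.rightMap V.X W.X q.f) W.δ) := by
      simp [extPull]
    have h₃ : extPush S.E (EndComplex.leftMap V.X W.X q.f)
          (extPull S.E (EndComplex.rightMap U.X V.X p.f) V.δ) =
        extPull S.E (EndComplex.rightMap U.X V.X p.f)
          (extPush S.E (EndComplex.leftMap V.X W.X q.f) V.δ) :=
      (NatTrans.naturality_apply (S.E.map (EndComplex.rightMap U.X V.X p.f).op)
        (EndComplex.leftMap V.X W.X q.f) V.δ).symm
    rw [leftMap_comp, rightMap_comp, h₁, h₂, p.comm, h₃, q.comm]⟩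
  id_comp _ := Hom.ext (Category.id_comp _)
  comp_id _ := Hom.ext (Category.comp_id _)
  assoc _ _ _ := Hom.ext (Category.assoc _ _ _)

end DistExangle

open DistExangle in
/-- The contravariant defect, `C(-,Xⁿ) ⟶ C(-,Xⁿ⁺¹) ⟶ defect ⟶ 0`, as a functor of the
distinguished `n`-exangle. -/
noncomputable def contraDefect : S.DistExangle ⥤ (Cᵒᵖ ⥤ AddCommGrpCat.{v}) where
  obj U := cokernel (preadditiveYoneda.map U.X.last)
  map {U V} p := cokernel.map _ _ (preadditiveYoneda.map (p.f.f n))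
    (preadditiveYoneda.map (EndComplex.rightMap U.X V.X p.f))
    (by rw [← Functor.map_comp, ← Functor.map_comp, last_comm])
  map_id U := by
    apply coequalizer.hom_ext
    change cokernel.π _ ≫ cokernel.map _ _ _ _ _ = cokernel.π _ ≫ 𝟙 _
    have h : EndComplex.rightMap U.X U.X (Hom.f (𝟙 U)) = 𝟙 _ := rightMap_id U
    rw [cokernel.π_desc, h, CategoryTheory.Functor.map_id, Category.id_comp, Category.comp_id]
  map_comp {U V W} p q := by
    apply coequalizer.hom_ext
    change cokernel.π _ ≫ cokernel.map _ _ _ _ _ =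
      cokernel.π _ ≫ cokernel.map _ _ _ _ _ ≫ cokernel.map _ _ _ _ _
    have h : EndComplex.rightMap U.X W.X (Hom.f (p ≫ q)) = _ := rightMap_comp p.f q.f
    rw [cokernel.π_desc, h, Functor.map_comp, cokernel.π_desc_assoc, Category.assoc,
      Category.assoc, cokernel.π_desc]

open DistExangle in
/-- The covariant defect, `C(X¹,-) ⟶ C(X⁰,-) ⟶ defect ⟶ 0`, as a contravariant functor of the
distinguished `n`-exangle. -/
noncomputable def coDefect : S.DistExangleᵒᵖ ⥤ (C ⥤ AddCommGrpCat.{v}) where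
  obj U := cokernel (preadditiveCoyoneda.map U.unop.X.first.op)
  map {V U} p := cokernel.map _ _ (preadditiveCoyoneda.map (p.unop.f.f 1).op)
    (preadditiveCoyoneda.map (EndComplex.leftMap U.unop.X V.unop.X p.unop.f).op)
    (by rw [← Functor.map_comp, ← Functor.map_comp, ← op_comp, ← op_comp, first_comm])
  map_id U := by
    apply coequalizer.hom_ext
    change cokernel.π _ ≫ cokernel.map _ _ _ _ _ = cokernel.π _ ≫ 𝟙 _
    have h : EndComplex.leftMap U.unop.X U.unop.X (Hom.f (𝟙 U.unop)) = 𝟙 _ := leftMap_id U.unop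
    rw [cokernel.π_desc, unop_id, h, op_id, CategoryTheory.Functor.map_id, Category.id_comp,
      Category.comp_id]
  map_comp {U V W} p q := by
    apply coequalizer.hom_ext
    change cokernel.π _ ≫ cokernel.map _ _ _ _ _ =
      cokernel.π _ ≫ cokernel.map _ _ _ _ _ ≫ cokernel.map _ _ _ _ _
    have h : EndComplex.leftMap W.unop.X U.unop.X (Hom.f (q.unop ≫ p.unop)) = _ :=
      leftMap_comp q.unop.f p.unop.f
    rw [cokernel.π_desc, unop_comp, h, op_comp, Functor.map_comp, cokernel.π_desc_assoc,
      Category.assoc, Category.assoc, cokernel.π_desc]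

end NExangulated

/-! The category of distinguished $n$-exangles maps to both sides of the duality, by the
contravariant defect on one side and, contravariantly, by the covariant defect on the other. Both
functors are full and essentially surjective and identify the same morphisms, so both targets are
the same quotient of that category; this is `exists_equivalence_of_homRel_eq`. The duality is
therefore never constructed by hand, and its compatibility with defects holds by construction.

The functors identify the same morphisms because $c\mapsto c^*\rho$ embeds the contravariant defect
of $\langle Y^\bullet,\rho\rangle$ in $\mathbb E(-,Y^0)$. Hence $p,q:\langle
X^\bullet,\delta\rangle\to\langle Y^\bullet,\rho\rangle$ agree on contravariant defects iff
$(p^{n+1})^*\rho=(q^{n+1})^*\rho$. Dually they agree on covariant defects iff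
$(p^0)_*\delta=(q^0)_*\delta$, and for morphisms of exangles the two conditions coincide.

Fullness rests on exactness of $\mathcal C(X^0,T)\to\mathbb E(X^{n+1},T)\to\mathbb E(X^n,T)$
(`exists_extPush_eq`) and its dual (`exists_extPull_eq`), obtained from good lifts: given one end of
a morphism of exangles, they supply the other, and (R0) fills in the chain map. Essential
surjectivity uses mapping cones: for $f:D\to B$ and $p:P\to B$ the end of an exangle with $P$
projective, $(f,p)$ again ends an exangle, and it has the cokernel of $f$ once $P$ is killed.

The two special values come from exangles with projective or injective middle terms, where one
defect is representable and the other is an extension functor. -/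

/-- Two full and essentially surjective functors that identify the same morphisms have
equivalent targets. -/
theorem exists_equivalence_of_homRel_eq {D M N : Type*} [Category* D] [Category* M] [Category* N]
    (F : D ⥤ M) (G : D ⥤ N) [F.Full] [F.EssSurj] [G.Full] [G.EssSurj]
    (h : ∀ ⦃X Y : D⦄ (f g : X ⟶ Y), F.map f = F.map g ↔ G.map f = G.map g) :
    ∃ e : M ≌ N, Nonempty (F ⋙ e.functor ≅ G) := by
  -- Both targets are equivalent to the quotient of `D` by this common relation; the required
  -- equivalence is the inverse of one comparison followed by the other.
  have hrel : F.homRel = G.homRel := by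
    funext X Y f g
    exact propext (h f g)
  let F' := CategoryTheory.Quotient.lift F.homRel F (by simp)
  let G' : CategoryTheory.Quotient F.homRel ⥤ N :=
    CategoryTheory.Quotient.lift F.homRel G fun _ _ f g hfg => (h f g).1 hfg
  have : F'.IsEquivalence :=
    inferInstanceAs (CategoryTheory.Quotient.lift F.homRel F _).IsEquivalence
  have : G'.IsEquivalence :=
    { full := ⟨by
        rintro ⟨X⟩ ⟨Y⟩ k
        obtain ⟨f, rfl⟩ := G.map_surjective k
        exact ⟨(CategoryTheory.Quotient.functor F.homRel).map f, rfl⟩⟩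
      faithful := ⟨by
        rintro ⟨X⟩ ⟨Y⟩ f g hfg
        obtain ⟨f, rfl⟩ := (CategoryTheory.Quotient.functor F.homRel).map_surjective f
        obtain ⟨g, rfl⟩ := (CategoryTheory.Quotient.functor F.homRel).map_surjective g
        exact (CategoryTheory.Quotient.functor_map_eq_iff _ f g).2 ((h f g).2 hfg)⟩
      essSurj := ⟨fun Y => ⟨⟨G.objPreimage Y⟩, ⟨G.objObjPreimageIso Y⟩⟩⟩ }
  refine ⟨F'.asEquivalence.symm.trans G'.asEquivalence, ⟨?_⟩⟩
  exact Functor.isoWhiskerLeft (CategoryTheory.Quotient.functor F.homRel)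
    ((Functor.associator _ _ _).symm ≪≫
      Functor.isoWhiskerRight F'.asEquivalence.unitIso.symm G' ≪≫ Functor.leftUnitor G')

/-! ### Pointwise description of cokernels of functors to abelian groups. -/

section Cokernel

variable {D : Type*} [Category* D] {G₁ G₂ G : D ⥤ AddCommGrpCat.{v}} (g : G₁ ⟶ G₂)

theorem cokernel_π_app_surjective (T : D) : Function.Surjective ((cokernel.π g).app T).hom :=
  (AddCommGrpCat.epi_iff_surjective _).1 inferInstance

theorem cokernel_π_app_eq_zero_iff {T : D} (x : G₂.obj T) :
    ((cokernel.π g).app T).hom x = 0 ↔ ∃ y : G₁.obj T, (g.app T).hom y = x := by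
  have h := (ShortComplex.exact_cokernel g).map ((evaluation D AddCommGrpCat.{v}).obj T)
  rw [ShortComplex.ab_exact_iff] at h
  refine ⟨fun hx => h x hx, ?_⟩
  rintro ⟨y, rfl⟩
  exact congr($(NatTrans.congr_app (cokernel.condition g) T).hom y)

/-- Isomorphisms are tested pointwise. Every element of the cokernel is the class of some `x`, so
`hk` yields injectivity and `hs` surjectivity. -/
theorem isIso_cokernel_desc (p : G₂ ⟶ G) (w : g ≫ p = 0)
    (hs : ∀ T, Function.Surjective (p.app T).hom)
    (hk : ∀ T (x : G₂.obj T), (p.app T).hom x = 0 → ∃ y : G₁.obj T, (g.app T).hom y = x) :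
    IsIso (cokernel.desc g p w) := by
  rw [NatTrans.isIso_iff_isIso_app]
  intro T
  rw [ConcreteCategory.isIso_iff_bijective]
  have hp (x : G₂.obj T) : ((cokernel.desc g p w).app T).hom (((cokernel.π g).app T).hom x) =
      (p.app T).hom x :=
    congr($(NatTrans.congr_app (cokernel.π_desc g p w) T).hom x)
  constructor
  · refine (injective_iff_map_eq_zero ((cokernel.desc g p w).app T).hom).2 fun z hz => ?_
    obtain ⟨x, rfl⟩ := cokernel_π_app_surjective g T z
    rw [hp] at hz
    exact (cokernel_π_app_eq_zero_iff g x).2 (hk T x hz)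
  · intro z
    obtain ⟨x, rfl⟩ := hs T z
    exact ⟨_, hp x⟩

/-- A pointwise surjection whose kernel is the image of `g` exhibits its target as the cokernel
of `g`. -/
noncomputable def cokernelDescIso (p : G₂ ⟶ G) (w : g ≫ p = 0)
    (hs : ∀ T, Function.Surjective (p.app T).hom)
    (hk : ∀ T (x : G₂.obj T), (p.app T).hom x = 0 → ∃ y : G₁.obj T, (g.app T).hom y = x) :
    cokernel g ≅ G :=
  @asIso _ _ _ _ (cokernel.desc g p w) (isIso_cokernel_desc g p w hs hk)

lemma π_cokernelDescIso_hom (p : G₂ ⟶ G) (w : g ≫ p = 0)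
    (hs : ∀ T, Function.Surjective (p.app T).hom)
    (hk : ∀ T (x : G₂.obj T), (p.app T).hom x = 0 → ∃ y : G₁.obj T, (g.app T).hom y = x) :
    cokernel.π g ≫ (cokernelDescIso g p w hs hk).hom = p :=
  cokernel.π_desc _ _ _

end Cokernel

/-! ### Morphisms between finitely presented functors. -/

section Presentations

variable {A : Type u} [Category.{v} A] [Preadditive A]

lemma preadditiveYoneda_map_zero (X Y : A) : preadditiveYoneda.map (0 : X ⟶ Y) = 0 := by
  ext T x
  exact comp_zero

lemma preadditiveCoyoneda_map_zero (X Y : A) :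
    preadditiveCoyoneda.map (0 : X ⟶ Y).op = 0 := by
  ext T x
  exact zero_comp

theorem preadditiveYoneda_hom_apply {X : A} {F : Aᵒᵖ ⥤ AddCommGrpCat.{v}}
    (φ : preadditiveYoneda.obj X ⟶ F) {T : A} (x : T ⟶ X) :
    (φ.app (op T)).hom x = (F.map x.op).hom ((φ.app (op X)).hom (𝟙 X)) := by
  have h : (φ.app (op T)).hom (x ≫ 𝟙 X) = (F.map x.op).hom ((φ.app (op X)).hom (𝟙 X)) :=
    congr($(φ.naturality x.op).hom (𝟙 X))
  rwa [Category.comp_id] at h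

theorem preadditiveYoneda_hom_ext {X : A} {F : Aᵒᵖ ⥤ AddCommGrpCat.{v}}
    {φ ψ : preadditiveYoneda.obj X ⟶ F}
    (h : (φ.app (op X)).hom (𝟙 X) = (ψ.app (op X)).hom (𝟙 X)) : φ = ψ := by
  ext T x
  exact (preadditiveYoneda_hom_apply φ x).trans
    ((congrArg _ h).trans (preadditiveYoneda_hom_apply ψ x).symm)

theorem preadditiveCoyoneda_hom_apply {X : A} {F : A ⥤ AddCommGrpCat.{v}}
    (φ : preadditiveCoyoneda.obj (op X) ⟶ F) {T : A} (x : X ⟶ T) :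
    (φ.app T).hom x = (F.map x).hom ((φ.app X).hom (𝟙 X)) := by
  have h : (φ.app T).hom (𝟙 X ≫ x) = (F.map x).hom ((φ.app X).hom (𝟙 X)) :=
    congr($(φ.naturality x).hom (𝟙 X))
  rwa [Category.id_comp] at h

theorem preadditiveCoyoneda_hom_ext {X : A} {F : A ⥤ AddCommGrpCat.{v}}
    {φ ψ : preadditiveCoyoneda.obj (op X) ⟶ F}
    (h : (φ.app X).hom (𝟙 X) = (ψ.app X).hom (𝟙 X)) : φ = ψ := by
  ext T x
  exact (preadditiveCoyoneda_hom_apply φ x).trans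
    ((congrArg _ h).trans (preadditiveCoyoneda_hom_apply ψ x).symm)

variable {X Y X' Y' : A} (f : X ⟶ Y) (g : X' ⟶ Y')

/-- By Yoneda the two transformations are the classes of `c` and `c'` in the cokernel at `T`, which
agree exactly when the difference lies in the image of `f`. -/
theorem preadditiveYoneda_map_comp_π_eq_iff {T : A} (c c' : T ⟶ Y) :
    preadditiveYoneda.map c ≫ cokernel.π (preadditiveYoneda.map f) =
      preadditiveYoneda.map c' ≫ cokernel.π (preadditiveYoneda.map f) ↔
    ∃ y : T ⟶ X, y ≫ f = c - c' := by
  let q : (T ⟶ Y) →+ (cokernel (preadditiveYoneda.map f)).obj (op T) :=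
    ((cokernel.π (preadditiveYoneda.map f)).app (op T)).hom
  have hq (d : T ⟶ Y) : ((preadditiveYoneda.map d ≫
      cokernel.π (preadditiveYoneda.map f)).app (op T)).hom (𝟙 T) = q d :=
    congrArg q (Category.id_comp d)
  have h₀ : q c = q c' ↔ ∃ y : T ⟶ X, y ≫ f = c - c' := by
    rw [← sub_eq_zero, ← map_sub]
    exact cokernel_π_app_eq_zero_iff (preadditiveYoneda.map f) (T := op T) (c - c')
  rw [← h₀, ← hq c, ← hq c']
  exact ⟨fun h => by rw [h], fun h => preadditiveYoneda_hom_ext h⟩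

/-- Representables are projective, so `φ` lifts to the presentations: `c` represents the image of
the class of `𝟙 Y`, and `f ≫ c` dies in the target cokernel, hence factors through `g`. -/
theorem exists_of_hom_cokernel_preadditiveYoneda
    (φ : cokernel (preadditiveYoneda.map f) ⟶ cokernel (preadditiveYoneda.map g)) :
    ∃ (c : Y ⟶ Y') (y : X ⟶ X'), f ≫ c = y ≫ g ∧
      cokernel.π _ ≫ φ = preadditiveYoneda.map c ≫ cokernel.π _ := by
  obtain ⟨c, hc⟩ : ∃ c : Y ⟶ Y', ((cokernel.π (preadditiveYoneda.map g)).app (op Y)).hom c =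
      ((cokernel.π (preadditiveYoneda.map f) ≫ φ).app (op Y)).hom (𝟙 Y) :=
    cokernel_π_app_surjective (preadditiveYoneda.map g) (op Y) _
  have h : cokernel.π (preadditiveYoneda.map f) ≫ φ =
      preadditiveYoneda.map c ≫ cokernel.π (preadditiveYoneda.map g) := by
    apply preadditiveYoneda_hom_ext
    rw [← hc]
    exact congrArg ((cokernel.π (preadditiveYoneda.map g)).app (op Y)).hom (Category.id_comp c).symm
  have h' : preadditiveYoneda.map (f ≫ c) ≫ cokernel.π (preadditiveYoneda.map g) =
      preadditiveYoneda.map 0 ≫ cokernel.π (preadditiveYoneda.map g) := by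
    rw [Functor.map_comp, Category.assoc, ← h, cokernel.condition_assoc, preadditiveYoneda_map_zero,
      zero_comp, zero_comp]
  obtain ⟨y, hy⟩ := (preadditiveYoneda_map_comp_π_eq_iff g _ _).1 h'
  exact ⟨c, y, by simp [hy], h⟩

theorem preadditiveCoyoneda_map_comp_π_eq_iff {T : A} (c c' : X ⟶ T) :
    preadditiveCoyoneda.map c.op ≫ cokernel.π (preadditiveCoyoneda.map f.op) =
      preadditiveCoyoneda.map c'.op ≫ cokernel.π (preadditiveCoyoneda.map f.op) ↔
    ∃ y : Y ⟶ T, f ≫ y = c - c' := by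
  let q : (X ⟶ T) →+ (cokernel (preadditiveCoyoneda.map f.op)).obj T :=
    ((cokernel.π (preadditiveCoyoneda.map f.op)).app T).hom
  have hq (d : X ⟶ T) : ((preadditiveCoyoneda.map d.op ≫
      cokernel.π (preadditiveCoyoneda.map f.op)).app T).hom (𝟙 T) = q d :=
    congrArg q (Category.comp_id d)
  have h₀ : q c = q c' ↔ ∃ y : Y ⟶ T, f ≫ y = c - c' := by
    rw [← sub_eq_zero, ← map_sub]
    exact cokernel_π_app_eq_zero_iff (preadditiveCoyoneda.map f.op) (T := T) (c - c')
  rw [← h₀, ← hq c, ← hq c']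
  exact ⟨fun h => by rw [h], fun h => preadditiveCoyoneda_hom_ext h⟩

/-- Dual lifting; covariant representables reverse arrows, so the square goes from `g` to `f`. -/
theorem exists_of_hom_cokernel_preadditiveCoyoneda
    (φ : cokernel (preadditiveCoyoneda.map f.op) ⟶ cokernel (preadditiveCoyoneda.map g.op)) :
    ∃ (c : X' ⟶ X) (y : Y' ⟶ Y), c ≫ f = g ≫ y ∧
      cokernel.π _ ≫ φ = preadditiveCoyoneda.map c.op ≫ cokernel.π _ := by
  obtain ⟨c, hc⟩ : ∃ c : X' ⟶ X, ((cokernel.π (preadditiveCoyoneda.map g.op)).app X).hom c =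
      ((cokernel.π (preadditiveCoyoneda.map f.op) ≫ φ).app X).hom (𝟙 X) :=
    cokernel_π_app_surjective (preadditiveCoyoneda.map g.op) X _
  have h : cokernel.π (preadditiveCoyoneda.map f.op) ≫ φ =
      preadditiveCoyoneda.map c.op ≫ cokernel.π (preadditiveCoyoneda.map g.op) := by
    apply preadditiveCoyoneda_hom_ext
    rw [← hc]
    exact congrArg ((cokernel.π (preadditiveCoyoneda.map g.op)).app X).hom (Category.comp_id c).symm
  have h' : preadditiveCoyoneda.map (c ≫ f).op ≫ cokernel.π (preadditiveCoyoneda.map g.op) =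
      preadditiveCoyoneda.map (0 : X' ⟶ Y).op ≫ cokernel.π (preadditiveCoyoneda.map g.op) := by
    rw [op_comp, Functor.map_comp, Category.assoc, ← h, cokernel.condition_assoc,
      preadditiveCoyoneda_map_zero, zero_comp, zero_comp]
  obtain ⟨y, hy⟩ := (preadditiveCoyoneda_map_comp_π_eq_iff g _ _).1 h'
  exact ⟨c, y, by simp [hy], h⟩

end Presentations

/-! ### Functoriality of push-forward and pull-back of extensions. -/

section Extensions

variable {C : Type u} [Category.{v} C] (E : Cᵒᵖ ⥤ C ⥤ AddCommGrpCat.{v})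

@[simp]
lemma extPush_id {A B : C} (δ : (E.obj (op B)).obj A) : extPush E (𝟙 A) δ = δ := by
  simp [extPush]

@[simp]
lemma extPull_id {A B : C} (δ : (E.obj (op B)).obj A) : extPull E (𝟙 B) δ = δ := by
  simp [extPull]

lemma extPush_comp {A₁ A₂ A₃ B : C} (a : A₁ ⟶ A₂) (b : A₂ ⟶ A₃) (δ : (E.obj (op B)).obj A₁) :
    extPush E (a ≫ b) δ = extPush E b (extPush E a δ) := by
  simp [extPush]

lemma extPull_comp {A B₁ B₂ B₃ : C} (a : B₁ ⟶ B₂) (b : B₂ ⟶ B₃) (δ : (E.obj (op B₃)).obj A) :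
    extPull E (a ≫ b) δ = extPull E a (extPull E b δ) := by
  simp [extPull]

@[simp]
lemma extPush_add {A A₁ B : C} (a : A ⟶ A₁) (δ ρ : (E.obj (op B)).obj A) :
    extPush E a (δ + ρ) = extPush E a δ + extPush E a ρ :=
  map_add _ _ _

@[simp]
lemma extPull_add {A B B₁ : C} (c : B₁ ⟶ B) (δ ρ : (E.obj (op B)).obj A) :
    extPull E c (δ + ρ) = extPull E c δ + extPull E c ρ :=
  map_add _ _ _

@[simp]
lemma extPush_zero {A A₁ B : C} (a : A ⟶ A₁) : extPush E (B := B) a 0 = 0 := map_zero _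

@[simp]
lemma extPull_zero {A B B₁ : C} (c : B₁ ⟶ B) : extPull E (A := A) c 0 = 0 := map_zero _

lemma extPush_extPull {A A₁ B B₁ : C} (a : A ⟶ A₁) (c : B₁ ⟶ B) (δ : (E.obj (op B)).obj A) :
    extPush E a (extPull E c δ) = extPull E c (extPush E a δ) :=
  (NatTrans.naturality_apply (E.map c.op) a δ).symm

end Extensions

/-! ### Exact sequences of extension groups, and exangles obtained from mapping cones. -/

namespace NExangulated

variable {C : Type u} [Category.{v} C] [Preadditive C] [HasZeroObject C]
  [HasBinaryBiproducts C] {n : ℕ} (S : NExangulated C n)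

lemma add_extPush {A A₁ B : C} (a b : A ⟶ A₁) (δ : (S.E.obj (op B)).obj A) :
    extPush S.E (a + b) δ = extPush S.E a δ + extPush S.E b δ := by
  have := S.additive_right (op B)
  simp [extPush, Functor.map_add]

lemma add_extPull {A B B₁ : C} (a b : B₁ ⟶ B) (δ : (S.E.obj (op B)).obj A) :
    extPull S.E (a + b) δ = extPull S.E a δ + extPull S.E b δ := by
  have := S.additive_left A
  have h : (S.E.flip.obj A).map (a + b).op =
      (S.E.flip.obj A).map a.op + (S.E.flip.obj A).map b.op := by
    rw [op_add, Functor.map_add]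
  exact congr($(h).hom δ)

@[simp]
lemma zero_extPush {A A₁ B : C} (δ : (S.E.obj (op B)).obj A) :
    extPush S.E (0 : A ⟶ A₁) δ = 0 := by
  simpa using S.add_extPush (0 : A ⟶ A₁) 0 δ

@[simp]
lemma zero_extPull {A B B₁ : C} (δ : (S.E.obj (op B)).obj A) :
    extPull S.E (0 : B₁ ⟶ B) δ = 0 := by
  simpa using S.add_extPull (0 : B₁ ⟶ B) 0 δ

lemma extPush_sub_eq_zero_iff {A A₁ B : C} (a b : A ⟶ A₁) (δ : (S.E.obj (op B)).obj A) :
    extPush S.E (a - b) δ = 0 ↔ extPush S.E a δ = extPush S.E b δ := by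
  have h := S.add_extPush (a - b) b δ
  rw [sub_add_cancel] at h
  rw [h, add_eq_right]

lemma extPull_sub_eq_zero_iff {A B B₁ : C} (a b : B₁ ⟶ B) (δ : (S.E.obj (op B)).obj A) :
    extPull S.E (a - b) δ = 0 ↔ extPull S.E a δ = extPull S.E b δ := by
  have h := S.add_extPull (a - b) b δ
  rw [sub_add_cancel] at h
  rw [h, add_eq_right]

variable {S} {A B : C} {δ : (S.E.obj (op B)).obj A} {X : EndComplex n A B}

lemma extPull_last (hX : S.realizes δ X) : extPull S.E X.last δ = 0 :=
  ((S.isExangle δ X hX).exact_left_end _ _).2 ⟨𝟙 _, by simp⟩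

lemma extPush_first (hX : S.realizes δ X) : extPush S.E X.first δ = 0 :=
  ((S.isExangle δ X hX).exact_right_end _ _).2 ⟨𝟙 _, by simp⟩

/-- Exactness of `C(T, Xⁿ⁺¹) ⟶ E(T, X⁰) ⟶ E(T, X¹)`. -/
theorem exists_extPull_eq (hn : 1 ≤ n) (hX : S.realizes δ X) {T : C}
    (θ : (S.E.obj (op T)).obj A) (hθ : extPush S.E X.first θ = 0) :
    ∃ c : T ⟶ B, extPull S.E c δ = θ := by
  -- Glue `θ` and `δ` into one extension by `T ⊞ B`. Its restriction along `biprod.inr` is `δ`, so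
  -- (EA2) applies to `X` and a realization `Z` of `ρ`.
  let ρ : (S.E.obj (op (T ⊞ B))).obj A :=
    extPull S.E biprod.fst θ + extPull S.E biprod.snd δ
  have hl : extPull S.E biprod.inl ρ = θ := by simp [ρ, ← extPull_comp]
  have hr : extPull S.E biprod.inr ρ = δ := by simp [ρ, ← extPull_comp]
  obtain ⟨Z, hZ⟩ := S.exists_realizes ρ
  obtain ⟨f, M, -, hf, ⟨e, -, -, he⟩, hM⟩ :=
    S.exists_good_lift ρ biprod.inr X Z (by rwa [hr]) hZ
  have h₀ : extPush S.E X.first ρ = 0 := by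
    simp [ρ, extPush_extPull, hθ, extPush_first hX]
  rw [h₀] at hM
  -- The cone realizes the push-forward of `ρ` along `X.first`, which is zero, so its last map
  -- `(inr, Z.last)` has a section `y`.
  obtain ⟨y, hy⟩ := ((S.isExangle _ M hM).exact_left_end _ (𝟙 _)).1 (by simp)
  have hf' : f.f (n + 1) ≫ Z.right.hom = X.right.hom ≫ biprod.inr := by
    rw [← hf]
    simp [EndComplex.rightMap]
  let s := biprod.inl ≫ y ≫ (e n hn le_rfl).hom
  -- Pulling `ρ` back along this decomposition turns the left side into `θ`; on the right the term
  -- through `Z.last` vanishes, and the other is a pull-back of `δ`.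
  have hs : biprod.inl = (s ≫ biprod.fst ≫ X.right.hom) ≫ biprod.inr +
      (s ≫ biprod.snd) ≫ Z.last := by
    calc biprod.inl = biprod.inl ≫ y ≫ M.last := by simp [hy]
      _ = s ≫ biprod.desc (X.right.hom ≫ biprod.inr) Z.last := by
        rw [he hn, hf']
        simp [s]
      _ = _ := by
        rw [biprod.desc_eq]
        simp
  refine ⟨s ≫ biprod.fst ≫ X.right.hom, ?_⟩
  rw [← hl]
  rw [hs]
  rw [add_extPull, extPull_comp S.E _ biprod.inr, hr, extPull_comp S.E _ Z.last, extPull_last hZ,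
    extPull_zero, add_zero]

/-- Exactness of `C(X⁰, T) ⟶ E(Xⁿ⁺¹, T) ⟶ E(Xⁿ, T)`. -/
theorem exists_extPush_eq (hn : 1 ≤ n) (hX : S.realizes δ X) {T : C}
    (θ : (S.E.obj (op B)).obj T) (hθ : extPull S.E X.last θ = 0) :
    ∃ a : A ⟶ T, extPush S.E a δ = θ := by
  -- The dual gluing. The cocone realizes the pull-back of `ρ` along `X.last`, which is zero, so its
  -- first map has a retraction, and `biprod.fst` splits into a part through `Z.first` and a part
  -- through `biprod.snd`.
  let ρ : (S.E.obj (op B)).obj (T ⊞ A) :=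
    extPush S.E biprod.inl θ + extPush S.E biprod.inr δ
  have hl : extPush S.E biprod.fst ρ = θ := by simp [ρ, ← extPush_comp]
  have hr : extPush S.E biprod.snd ρ = δ := by simp [ρ, ← extPush_comp]
  obtain ⟨Z, hZ⟩ := S.exists_realizes ρ
  obtain ⟨f, N, hf, -, ⟨e, he, -, -⟩, hN⟩ :=
    S.exists_good_lift_dual ρ biprod.snd Z X hZ (by rwa [hr])
  have h₀ : extPull S.E X.last ρ = 0 := by
    simp [ρ, ← extPush_extPull, hθ, extPull_last hX]
  rw [h₀] at hN
  obtain ⟨y, hy⟩ := ((S.isExangle _ N hN).exact_right_end _ (𝟙 _)).1 (by simp)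
  have hf' : Z.left.inv ≫ f.f 0 = biprod.snd ≫ X.left.inv := by
    rw [← hf]
    simp [EndComplex.leftMap]
  let s := (e 0 hn).inv ≫ y ≫ biprod.fst
  have hs : biprod.fst = Z.first ≫ biprod.inl ≫ s + biprod.snd ≫ X.left.inv ≫ biprod.inr ≫ s := by
    calc biprod.fst = N.first ≫ y ≫ biprod.fst := by simp [reassoc_of% hy]
      _ = biprod.lift Z.first (biprod.snd ≫ X.left.inv) ≫ s := by
        rw [← hf', ← he hn]
        simp [s]
      _ = _ := by
        rw [biprod.lift_eq]
        simp
  refine ⟨X.left.inv ≫ biprod.inr ≫ s, ?_⟩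
  rw [← hl]
  rw [hs]
  rw [add_extPush, extPush_comp S.E Z.first, extPush_first hZ, extPush_zero,
    extPush_comp S.E biprod.snd, hr]
  exact (zero_add _).symm

/-- An extension by a projective object vanishes. -/
lemma eq_zero_of_proj {P : C} (hP : S.proj P) (θ : (S.E.obj (op P)).obj A) : θ = 0 := by
  obtain ⟨Z, hZ⟩ := S.exists_realizes θ
  have := ((S.isExangle θ Z hZ).exact_left_end _ (𝟙 _)).2 (hP θ Z hZ _)
  simpa using this

/-- An extension of an injective object vanishes. -/
lemma eq_zero_of_inj {I : C} (hI : S.inj I) (θ : (S.E.obj (op B)).obj I) : θ = 0 := by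
  obtain ⟨Z, hZ⟩ := S.exists_realizes θ
  have := ((S.isExangle θ Z hZ).exact_right_end _ (𝟙 _)).2 (hI θ Z hZ _)
  simpa using this

/-- If `p : P ⟶ Y` is the end of a distinguished `n`-exangle and `f : D ⟶ Y`, then
`(f, p) : D ⊞ P ⟶ Y` is the end of a distinguished `n`-exangle. -/
theorem exists_last_eq_desc (hn : 1 ≤ n) (hX : S.realizes δ X) {D : C} (f : D ⟶ B) :
    ∃ (A' : C) (ρ : (S.E.obj (op B)).obj A') (M : EndComplex n A' B)
      (e : M.K.X n ≅ D ⊞ X.K.X n),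
      S.realizes ρ M ∧ M.last = e.hom ≫ biprod.desc f X.last := by
  -- The wanted exangle is the mapping cone of a good lift of `f`; its last but one term is the sum
  -- of the end term `D` of `Z` and the `n`-th term of `X`.
  obtain ⟨Z, hZ⟩ := S.exists_realizes (extPull S.E f δ)
  obtain ⟨φ, M, -, hφ, ⟨e, -, -, he⟩, hM⟩ := S.exists_good_lift δ f Z X hZ hX
  refine ⟨_, _, M, e n hn le_rfl ≪≫ biprod.mapIso Z.right (Iso.refl _), hM, ?_⟩
  have hφ' : φ.f (n + 1) ≫ X.right.hom = Z.right.hom ≫ f := by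
    rw [← hφ]
    simp [EndComplex.rightMap]
  rw [he hn, hφ']
  simp only [Iso.trans_hom, Category.assoc, biprod.mapIso_hom, Iso.refl_hom]
  congr 1
  ext <;> simp

/-- If `i : Y ⟶ I` is the beginning of a distinguished `n`-exangle and `f : Y ⟶ D`, then
`(f, i) : Y ⟶ D ⊞ I` is the beginning of a distinguished `n`-exangle. -/
theorem exists_first_eq_lift (hn : 1 ≤ n) (hX : S.realizes δ X) {D : C} (f : A ⟶ D) :
    ∃ (B' : C) (ρ : (S.E.obj (op B')).obj A) (N : EndComplex n A B')
      (e : D ⊞ X.K.X 1 ≅ N.K.X 1),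
      S.realizes ρ N ∧ N.first = biprod.lift f X.first ≫ e.hom := by
  obtain ⟨Z, hZ⟩ := S.exists_realizes (extPush S.E f δ)
  obtain ⟨φ, N, hφ, -, ⟨e, he, -, -⟩, hN⟩ := S.exists_good_lift_dual δ f X Z hX hZ
  refine ⟨_, _, N, biprod.mapIso Z.left.symm (Iso.refl _) ≪≫ biprod.braiding _ _ ≪≫
    (e 0 hn).symm, hN, ?_⟩
  have hφ' : X.left.inv ≫ φ.f 0 = f ≫ Z.left.inv := by
    rw [← hφ]
    simp [EndComplex.leftMap]
  rw [← cancel_mono (e 0 hn).hom, he hn, hφ']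
  simp only [Iso.trans_hom, Category.assoc, biprod.mapIso_hom, Iso.refl_hom, Iso.symm_hom,
    Iso.inv_hom_id, Category.comp_id]
  ext <;> simp

end NExangulated

/-! ### Vanishing of morphisms in ideal quotients. -/

section IdealQuotient

variable {C : Type u} [Category.{v} C] [Preadditive C] [HasBinaryBiproducts C]
  (Q : ObjectProperty C) [ClosedUnderSums Q]

instance idealQuotient_functor_additive :
    (CategoryTheory.Quotient.functor (idealRel Q)).Additive :=
  CategoryTheory.Quotient.functor_additive _ (fun _ _ => idealRel_add Q)

lemma idealQuotient_map_eq_zero_iff {X Y : C} (f : X ⟶ Y) :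
    (CategoryTheory.Quotient.functor (idealRel Q)).map f = 0 ↔
      ∃ (P : C) (_ : Q P) (a : X ⟶ P) (b : P ⟶ Y), a ≫ b = f := by
  rw [← Functor.map_zero, CategoryTheory.Quotient.functor_map_eq_iff]
  simp [idealRel]

/-- Used to discard projective and injective summands after passing to the quotient. -/
lemma idealQuotient_map_eq_zero_of_target {P : C} (hP : Q P) {X : C} (f : X ⟶ P) :
    (CategoryTheory.Quotient.functor (idealRel Q)).map f = 0 :=
  (idealQuotient_map_eq_zero_iff Q f).2 ⟨P, hP, f, 𝟙 P, by simp⟩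

end IdealQuotient

/-! ### Defects over the stable and costable categories: which morphisms they identify, and
fullness. -/

namespace NExangulated

variable {C : Type u} [Category.{v} C] [Preadditive C] [HasZeroObject C]
  [HasBinaryBiproducts C] {n : ℕ} (S : NExangulated C n)

open DistExangle

/-- The contravariant defect as a finitely presented module over the stable category. -/
noncomputable def stableDefect : S.DistExangle ⥤ ModRight S.Stable :=
  (finPresRight S.Stable).lift
    { obj := fun U => cokernel (preadditiveYoneda.map (S.toStable.map U.X.last))
      map := fun {U V} p => cokernel.map _ _
        (preadditiveYoneda.map (S.toStable.map (p.f.f n)))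
        (preadditiveYoneda.map (S.toStable.map (EndComplex.rightMap U.X V.X p.f)))
        (by simp only [← Functor.map_comp, last_comm])
      map_id := fun U => by
        apply coequalizer.hom_ext
        change cokernel.π _ ≫ cokernel.map _ _ _ _ _ = cokernel.π _ ≫ 𝟙 _
        have h : EndComplex.rightMap U.X U.X (Hom.f (𝟙 U)) = 𝟙 _ := rightMap_id U
        rw [cokernel.π_desc, h, CategoryTheory.Functor.map_id, CategoryTheory.Functor.map_id,
          Category.id_comp, Category.comp_id]
      map_comp := fun {U V W} p q => by
        apply coequalizer.hom_ext
        change cokernel.π _ ≫ cokernel.map _ _ _ _ _ =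
          cokernel.π _ ≫ cokernel.map _ _ _ _ _ ≫ cokernel.map _ _ _ _ _
        have h : EndComplex.rightMap U.X W.X (Hom.f (p ≫ q)) = _ := rightMap_comp p.f q.f
        rw [cokernel.π_desc, h, Functor.map_comp, Functor.map_comp, cokernel.π_desc_assoc,
          Category.assoc, Category.assoc, cokernel.π_desc] }
    fun _ => ⟨_, _, _, ⟨Iso.refl _⟩⟩

/-- The covariant defect as a finitely presented module over the opposite of the costable
category. -/
noncomputable def costableDefect : S.DistExangleᵒᵖ ⥤ ModLeft S.Costable :=
  (finPresLeft S.Costable).lift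
    { obj := fun U => cokernel (preadditiveCoyoneda.map (S.toCostable.map U.unop.X.first).op)
      map := fun {V U} p => cokernel.map _ _
        (preadditiveCoyoneda.map (S.toCostable.map (p.unop.f.f 1)).op)
        (preadditiveCoyoneda.map
          (S.toCostable.map (EndComplex.leftMap U.unop.X V.unop.X p.unop.f)).op)
        (by simp only [← Functor.map_comp, ← op_comp, first_comm])
      map_id := fun U => by
        apply coequalizer.hom_ext
        change cokernel.π _ ≫ cokernel.map _ _ _ _ _ = cokernel.π _ ≫ 𝟙 _
        have h : EndComplex.leftMap U.unop.X U.unop.X (Hom.f (𝟙 U.unop)) = 𝟙 _ :=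
          leftMap_id U.unop
        rw [cokernel.π_desc, unop_id, h, CategoryTheory.Functor.map_id, op_id,
          CategoryTheory.Functor.map_id, Category.id_comp, Category.comp_id]
      map_comp := fun {U V W} p q => by
        apply coequalizer.hom_ext
        change cokernel.π _ ≫ cokernel.map _ _ _ _ _ =
          cokernel.π _ ≫ cokernel.map _ _ _ _ _ ≫ cokernel.map _ _ _ _ _
        have h : EndComplex.leftMap W.unop.X U.unop.X (Hom.f (q.unop ≫ p.unop)) = _ :=
          leftMap_comp q.unop.f p.unop.f
        rw [cokernel.π_desc, unop_comp, h, Functor.map_comp, op_comp, Functor.map_comp,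
          cokernel.π_desc_assoc, Category.assoc, Category.assoc, cokernel.π_desc] }
    fun _ => ⟨_, _, _, ⟨Iso.refl _⟩⟩

variable {S}

lemma π_stableDefect_map {U V : S.DistExangle} (p : U ⟶ V) :
    cokernel.π (preadditiveYoneda.map (S.toStable.map U.X.last)) ≫ (S.stableDefect.map p).hom =
      preadditiveYoneda.map (S.toStable.map (EndComplex.rightMap U.X V.X p.f)) ≫
        cokernel.π (preadditiveYoneda.map (S.toStable.map V.X.last)) :=
  cokernel.π_desc _ _ _

lemma π_costableDefect_map {U V : S.DistExangle} (p : U ⟶ V) :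
    cokernel.π (preadditiveCoyoneda.map (S.toCostable.map V.X.first).op) ≫
        (S.costableDefect.map p.op).hom =
      preadditiveCoyoneda.map (S.toCostable.map (EndComplex.leftMap U.X V.X p.f)).op ≫
        cokernel.π (preadditiveCoyoneda.map (S.toCostable.map U.X.first).op) :=
  cokernel.π_desc _ _ _

/-- A morphism to the last term of a distinguished `n`-exangle factors through the last
differential if it does so in the stable category. -/
lemma exists_comp_last_iff (V : S.DistExangle) {T : C} (c : T ⟶ V.B) :
    (∃ y : S.toStable.obj T ⟶ S.toStable.obj (V.X.K.X n),
      y ≫ S.toStable.map V.X.last = S.toStable.map c) ↔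
    ∃ y : T ⟶ V.X.K.X n, y ≫ V.X.last = c := by
  constructor
  · rintro ⟨y, hy⟩
    obtain ⟨y, rfl⟩ := S.toStable.map_surjective y
    rw [← Functor.map_comp, CategoryTheory.Quotient.functor_map_eq_iff] at hy
    obtain ⟨P, hP, a, b, hab⟩ := hy
    -- The error `y ≫ V.X.last - c` passes through the projective `P`, hence lifts through the last
    -- differential and can be subtracted from `y`.
    obtain ⟨z, hz⟩ := hP _ _ V.realizes b
    exact ⟨y - a ≫ z, by simp [hz, hab]⟩
  · rintro ⟨y, rfl⟩
    exact ⟨S.toStable.map y, by simp⟩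

/-- A morphism from the first term of a distinguished `n`-exangle factors through the first
differential if it does so in the costable category. -/
lemma exists_first_comp_iff (V : S.DistExangle) {T : C} (a : V.A ⟶ T) :
    (∃ y : S.toCostable.obj (V.X.K.X 1) ⟶ S.toCostable.obj T,
      S.toCostable.map V.X.first ≫ y = S.toCostable.map a) ↔
    ∃ y : V.X.K.X 1 ⟶ T, V.X.first ≫ y = a := by
  constructor
  · rintro ⟨y, hy⟩
    obtain ⟨y, rfl⟩ := S.toCostable.map_surjective y
    rw [← Functor.map_comp, CategoryTheory.Quotient.functor_map_eq_iff] at hy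
    obtain ⟨P, hP, b, c, hbc⟩ := hy
    obtain ⟨z, hz⟩ := hP _ _ V.realizes b
    exact ⟨y - z ≫ c, by simp [reassoc_of% hz, hbc]⟩
  · rintro ⟨y, rfl⟩
    exact ⟨S.toCostable.map y, by simp⟩

/-- Nothing is lost in the stable category: the defect still embeds in `E(-, V.A)` through `c ↦ c^*
δ`. -/
lemma exists_comp_last_iff_extPull (V : S.DistExangle) {T : C} (c c' : T ⟶ V.B) :
    (∃ y : S.toStable.obj T ⟶ S.toStable.obj (V.X.K.X n),
      y ≫ S.toStable.map V.X.last = S.toStable.map c - S.toStable.map c') ↔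
    extPull S.E c V.δ = extPull S.E c' V.δ := by
  rw [← Functor.map_sub, exists_comp_last_iff, ← extPull_sub_eq_zero_iff,
    (S.isExangle _ _ V.realizes).exact_left_end]

lemma exists_first_comp_iff_extPush (V : S.DistExangle) {T : C} (a a' : V.A ⟶ T) :
    (∃ y : S.toCostable.obj (V.X.K.X 1) ⟶ S.toCostable.obj T,
      S.toCostable.map V.X.first ≫ y = S.toCostable.map a - S.toCostable.map a') ↔
    extPush S.E a V.δ = extPush S.E a' V.δ := by
  rw [← Functor.map_sub, exists_first_comp_iff, ← extPush_sub_eq_zero_iff,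
    (S.isExangle _ _ V.realizes).exact_right_end]

/-- Only the pulled-back extension matters. By compatibility with extensions it equals a
push-forward of `U.δ`, which links it to the covariant side. -/
lemma stableDefect_map_eq_iff {U V : S.DistExangle} (p q : U ⟶ V) :
    S.stableDefect.map p = S.stableDefect.map q ↔
      extPull S.E (EndComplex.rightMap U.X V.X p.f) V.δ =
        extPull S.E (EndComplex.rightMap U.X V.X q.f) V.δ := by
  rw [← exists_comp_last_iff_extPull, ← preadditiveYoneda_map_comp_π_eq_iff,
    ← π_stableDefect_map, ← π_stableDefect_map]
  exact ⟨fun h => by rw [h], fun h => ObjectProperty.hom_ext _ (coequalizer.hom_ext h)⟩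

lemma costableDefect_map_eq_iff {U V : S.DistExangle} (p q : U ⟶ V) :
    S.costableDefect.map p.op = S.costableDefect.map q.op ↔
      extPush S.E (EndComplex.leftMap U.X V.X p.f) U.δ =
        extPush S.E (EndComplex.leftMap U.X V.X q.f) U.δ := by
  rw [← exists_first_comp_iff_extPush, ← preadditiveCoyoneda_map_comp_π_eq_iff,
    ← π_costableDefect_map, ← π_costableDefect_map]
  exact ⟨fun h => by rw [h], fun h => ObjectProperty.hom_ext _ (coequalizer.hom_ext h)⟩

theorem stableDefect_full (hn : 1 ≤ n) : S.stableDefect.Full where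
  map_surjective {U V} φ := by
    obtain ⟨c, y, hcy, hφ⟩ := exists_of_hom_cokernel_preadditiveYoneda _ _ φ.hom
    obtain ⟨c, rfl⟩ := S.toStable.map_surjective c
    obtain ⟨z, hz⟩ := (exists_comp_last_iff V (U.X.last ≫ c)).1 ⟨y, by simp [hcy]⟩
    -- Since `U.X.last ≫ c` factors through `V.X.last`, the extension `c^* V.δ` dies on `Uⁿ`, so it
    -- is `a_* U.δ` for some `a`; then `(a, c)` lifts to a chain map by (R0).
    obtain ⟨a, ha⟩ := exists_extPush_eq hn U.realizes (extPull S.E c V.δ) (by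
      rw [← extPull_comp, ← hz, extPull_comp, extPull_last V.realizes, extPull_zero])
    obtain ⟨f, rfl, rfl⟩ := S.exists_lift U.δ V.δ U.X V.X U.realizes V.realizes a c ha
    refine ⟨⟨f, ha⟩, ObjectProperty.hom_ext _ (coequalizer.hom_ext ?_)⟩
    exact (π_stableDefect_map _).trans hφ.symm

theorem costableDefect_full (hn : 1 ≤ n) : S.costableDefect.Full where
  map_surjective {V U} φ := by
    obtain ⟨V⟩ := V
    obtain ⟨U⟩ := U
    obtain ⟨a, y, hay, hφ⟩ := exists_of_hom_cokernel_preadditiveCoyoneda _ _ φ.hom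
    obtain ⟨a, rfl⟩ := S.toCostable.map_surjective a
    obtain ⟨z, hz⟩ := (exists_first_comp_iff U (a ≫ V.X.first)).1 ⟨y, by simp [hay]⟩
    obtain ⟨c, hc⟩ := exists_extPull_eq hn V.realizes (extPush S.E a U.δ) (by
      rw [← extPush_comp, ← hz, extPush_comp, extPush_first U.realizes, extPush_zero])
    obtain ⟨f, rfl, rfl⟩ := S.exists_lift U.δ V.δ U.X V.X U.realizes V.realizes a c hc.symm
    refine ⟨Quiver.Hom.op ⟨f, hc.symm⟩, ObjectProperty.hom_ext _ (coequalizer.hom_ext ?_)⟩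
    exact (π_costableDefect_map (U := U) (V := V) _).trans hφ.symm

end NExangulated

/-- Morphisms to the same object that factor through each other have isomorphic cokernels. -/
noncomputable def cokernelIsoOfFactors {D : Type*} [Category* D] [HasZeroMorphisms D] {X X' Y : D}
    (f : X ⟶ Y) (f' : X' ⟶ Y) [HasCokernel f] [HasCokernel f'] (a : X ⟶ X') (b : X' ⟶ X)
    (ha : a ≫ f' = f) (hb : b ≫ f = f') : cokernel f ≅ cokernel f' where
  hom := cokernel.desc f (cokernel.π f')
    (by rw [← ha, Category.assoc, cokernel.condition, comp_zero])
  inv := cokernel.desc f' (cokernel.π f)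
    (by rw [← hb, Category.assoc, cokernel.condition, comp_zero])

/-! ### Essential surjectivity, and comparison with the defects over `C`. -/

namespace NExangulated

variable {C : Type u} [Category.{v} C] [Preadditive C] [HasZeroObject C]
  [HasBinaryBiproducts C] {n : ℕ} {S : NExangulated C n}

theorem stableDefect_essSurj (hn : 1 ≤ n) (hP : S.EnoughProj) : S.stableDefect.EssSurj where
  mem_essImage := by
    rintro ⟨F, ⟨D⟩, ⟨B⟩, f, ⟨i⟩⟩
    obtain ⟨f, rfl⟩ := S.toStable.map_surjective f
    obtain ⟨A, δ, X, hX, hproj⟩ := hP B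
    obtain ⟨A', ρ, M, e, hM, he⟩ := exists_last_eq_desc hn hX f
    -- Cokernels agree by mutual factorization: `f` factors through `M.last` already in `C`, while
    -- `M.last` factors through `f` only once the projective summand is zero.
    have hl : (biprod.inl ≫ e.inv) ≫ M.last = f := by simp [he]
    have hr : S.toStable.map (e.hom ≫ biprod.fst) ≫ S.toStable.map f =
        S.toStable.map M.last := by
      have h : M.last = (e.hom ≫ biprod.fst) ≫ f + (e.hom ≫ biprod.snd) ≫ X.last := by
        rw [he, biprod.desc_eq]
        simp
      rw [h, Functor.map_add, Functor.map_comp _ (e.hom ≫ biprod.snd),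
        idealQuotient_map_eq_zero_of_target S.proj (hproj n hn le_rfl) (e.hom ≫ biprod.snd),
        zero_comp, add_zero, ← Functor.map_comp]
    refine ⟨⟨A', B, ρ, M, hM⟩, ⟨ObjectProperty.isoMk _ (cokernelIsoOfFactors _ _
      (preadditiveYoneda.map (S.toStable.map (e.hom ≫ biprod.fst)))
      (preadditiveYoneda.map (S.toStable.map (biprod.inl ≫ e.inv))) ?_ ?_ ≪≫ i)⟩⟩
    · rw [← Functor.map_comp, hr]
    · rw [← Functor.map_comp, ← Functor.map_comp, hl]

theorem costableDefect_essSurj (hn : 1 ≤ n) (hI : S.EnoughInj) :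
    S.costableDefect.EssSurj where
  mem_essImage := by
    rintro ⟨F, ⟨A⟩, ⟨D⟩, f, ⟨i⟩⟩
    obtain ⟨f, rfl⟩ := S.toCostable.map_surjective f
    obtain ⟨B, δ, X, hX, hinj⟩ := hI A
    obtain ⟨B', ρ, N, e, hN, he⟩ := exists_first_eq_lift hn hX f
    have hl : N.first ≫ e.inv ≫ biprod.fst = f := by simp [he]
    have hr : S.toCostable.map f ≫ S.toCostable.map (biprod.inl ≫ e.hom) =
        S.toCostable.map N.first := by
      have h : N.first = f ≫ biprod.inl ≫ e.hom + X.first ≫ biprod.inr ≫ e.hom := by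
        rw [he, biprod.lift_eq]
        simp
      rw [h, Functor.map_add, Functor.map_comp _ X.first,
        idealQuotient_map_eq_zero_of_target S.inj (hinj 1 le_rfl hn) X.first, zero_comp, add_zero,
        ← Functor.map_comp]
    refine ⟨op ⟨A, B', ρ, N, hN⟩, ⟨ObjectProperty.isoMk _ (cokernelIsoOfFactors _ _
      (preadditiveCoyoneda.map (S.toCostable.map (biprod.inl ≫ e.hom)).op)
      (preadditiveCoyoneda.map (S.toCostable.map (e.inv ≫ biprod.fst)).op) ?_ ?_ ≪≫ i)⟩⟩
    · rw [← Functor.map_comp, ← op_comp, hr]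
    · rw [← Functor.map_comp, ← op_comp, ← Functor.map_comp, hl]

/-- The projection from a representable functor to the contravariant defect, computed in the
stable category. -/
noncomputable def toStableDefect (U : S.DistExangle) :
    preadditiveYoneda.obj U.B ⟶ S.resStable.obj (S.stableDefect.obj U) :=
  { app := fun _ => AddCommGrpCat.ofHom S.toStable.mapAddHom
    naturality := fun _ _ f => by
      ext x
      exact S.toStable.map_comp f.unop x } ≫
  Functor.whiskerLeft S.toStable.op
    (cokernel.π (preadditiveYoneda.map (S.toStable.map U.X.last)))

/-- The projection from a representable functor to the covariant defect, computed in the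
costable category. -/
noncomputable def toCostableDefect (U : S.DistExangle) :
    preadditiveCoyoneda.obj (op U.A) ⟶ S.resCostable.obj (S.costableDefect.obj (op U)) :=
  { app := fun _ => AddCommGrpCat.ofHom S.toCostable.mapAddHom
    naturality := fun _ _ f => by
      ext x
      exact S.toCostable.map_comp x f } ≫
  Functor.whiskerLeft S.toCostable
    (cokernel.π (preadditiveCoyoneda.map (S.toCostable.map U.X.first).op))

lemma toStableDefect_app_surjective (U : S.DistExangle) (T : Cᵒᵖ) :
    Function.Surjective ((toStableDefect U).app T).hom := by
  intro z
  obtain ⟨x, rfl⟩ := cokernel_π_app_surjective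
    (preadditiveYoneda.map (S.toStable.map U.X.last)) (S.toStable.op.obj T) z
  obtain ⟨x, rfl⟩ := S.toStable.map_surjective x
  exact ⟨x, rfl⟩

lemma toStableDefect_app_eq_zero_iff (U : S.DistExangle) {T : C} (x : T ⟶ U.B) :
    ((toStableDefect U).app (op T)).hom x = 0 ↔ ∃ y : T ⟶ U.X.K.X n, y ≫ U.X.last = x :=
  (cokernel_π_app_eq_zero_iff (preadditiveYoneda.map (S.toStable.map U.X.last))
    (T := op (S.toStable.obj T)) (S.toStable.map x)).trans (exists_comp_last_iff U x)

lemma toCostableDefect_app_surjective (U : S.DistExangle) (T : C) :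
    Function.Surjective ((toCostableDefect U).app T).hom := by
  intro z
  obtain ⟨x, rfl⟩ := cokernel_π_app_surjective
    (preadditiveCoyoneda.map (S.toCostable.map U.X.first).op) (S.toCostable.obj T) z
  obtain ⟨x, rfl⟩ := S.toCostable.map_surjective x
  exact ⟨x, rfl⟩

lemma toCostableDefect_app_eq_zero_iff (U : S.DistExangle) {T : C} (x : U.A ⟶ T) :
    ((toCostableDefect U).app T).hom x = 0 ↔ ∃ y : U.X.K.X 1 ⟶ T, U.X.first ≫ y = x :=
  (cokernel_π_app_eq_zero_iff (preadditiveCoyoneda.map (S.toCostable.map U.X.first).op)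
    (T := S.toCostable.obj T) (S.toCostable.map x)).trans (exists_first_comp_iff U x)

lemma map_comp_toStableDefect {U V : S.DistExangle} (p : U ⟶ V) :
    preadditiveYoneda.map (EndComplex.rightMap U.X V.X p.f) ≫ toStableDefect V =
      toStableDefect U ≫ S.resStable.map (S.stableDefect.map p) := by
  apply preadditiveYoneda_hom_ext
  have h := congr($(NatTrans.congr_app (π_stableDefect_map p) (op (S.toStable.obj U.B))).hom
    (S.toStable.map (𝟙 U.B)))
  refine Eq.trans ?_ h.symm
  exact congrArg ((cokernel.π (preadditiveYoneda.map (S.toStable.map V.X.last))).app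
    (op (S.toStable.obj U.B))).hom (S.toStable.map_comp (𝟙 U.B) _)

lemma map_comp_toCostableDefect {U V : S.DistExangle} (p : U ⟶ V) :
    preadditiveCoyoneda.map (EndComplex.leftMap U.X V.X p.f).op ≫ toCostableDefect U =
      toCostableDefect V ≫ S.resCostable.map (S.costableDefect.map p.op) := by
  apply preadditiveCoyoneda_hom_ext
  have h := congr($(NatTrans.congr_app (π_costableDefect_map p) (S.toCostable.obj V.A)).hom
    (S.toCostable.map (𝟙 V.A)))
  refine Eq.trans ?_ h.symm
  exact congrArg ((cokernel.π (preadditiveCoyoneda.map (S.toCostable.map U.X.first).op)).app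
    (S.toCostable.obj V.A)).hom (S.toCostable.map_comp _ (𝟙 V.A))

lemma map_last_comp_toStableDefect (U : S.DistExangle) :
    preadditiveYoneda.map U.X.last ≫ toStableDefect U = 0 :=
  preadditiveYoneda_hom_ext ((toStableDefect_app_eq_zero_iff U _).2 ⟨𝟙 _, rfl⟩)

lemma map_first_comp_toCostableDefect (U : S.DistExangle) :
    preadditiveCoyoneda.map U.X.first.op ≫ toCostableDefect U = 0 :=
  preadditiveCoyoneda_hom_ext ((toCostableDefect_app_eq_zero_iff U _).2 ⟨𝟙 _, rfl⟩)

/-- The projection from a representable functor to the contravariant defect. -/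
noncomputable def contraDefectπ (U : S.DistExangle) :
    preadditiveYoneda.obj U.B ⟶ S.contraDefect.obj U :=
  cokernel.π (preadditiveYoneda.map U.X.last)

/-- The projection from a representable functor to the covariant defect. -/
noncomputable def coDefectπ (U : S.DistExangle) :
    preadditiveCoyoneda.obj (op U.A) ⟶ S.coDefect.obj (op U) :=
  cokernel.π (preadditiveCoyoneda.map U.X.first.op)

instance epi_contraDefectπ (U : S.DistExangle) : Epi (contraDefectπ U) :=
  inferInstanceAs (Epi (cokernel.π (preadditiveYoneda.map U.X.last)))

instance epi_coDefectπ (U : S.DistExangle) : Epi (coDefectπ U) :=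
  inferInstanceAs (Epi (cokernel.π (preadditiveCoyoneda.map U.X.first.op)))

lemma contraDefectπ_map {U V : S.DistExangle} (p : U ⟶ V) :
    contraDefectπ U ≫ S.contraDefect.map p =
      preadditiveYoneda.map (EndComplex.rightMap U.X V.X p.f) ≫ contraDefectπ V :=
  cokernel.π_desc _ _ _

lemma coDefectπ_map {U V : S.DistExangle} (p : U ⟶ V) :
    coDefectπ V ≫ S.coDefect.map p.op =
      preadditiveCoyoneda.map (EndComplex.leftMap U.X V.X p.f).op ≫ coDefectπ U :=
  cokernel.π_desc _ _ _

/-- The contravariant defect of one distinguished `n`-exangle, computed in the stable category. -/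
noncomputable def contraDefectObjIso (U : S.DistExangle) :
    S.contraDefect.obj U ≅ S.resStable.obj (S.stableDefect.obj U) :=
  cokernelDescIso _ (toStableDefect U) (map_last_comp_toStableDefect U)
    (toStableDefect_app_surjective U) (fun _ _ => (toStableDefect_app_eq_zero_iff U _).1)

/-- The covariant defect of one distinguished `n`-exangle, computed in the costable category. -/
noncomputable def coDefectObjIso (U : S.DistExangle) :
    S.coDefect.obj (op U) ≅ S.resCostable.obj (S.costableDefect.obj (op U)) :=
  cokernelDescIso _ (toCostableDefect U) (map_first_comp_toCostableDefect U)
    (toCostableDefect_app_surjective U) (fun _ _ => (toCostableDefect_app_eq_zero_iff U _).1)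

lemma contraDefectπ_objIso (U : S.DistExangle) :
    contraDefectπ U ≫ (contraDefectObjIso U).hom = toStableDefect U :=
  π_cokernelDescIso_hom _ _ _ _ _

lemma coDefectπ_objIso (U : S.DistExangle) :
    coDefectπ U ≫ (coDefectObjIso U).hom = toCostableDefect U :=
  π_cokernelDescIso_hom _ _ _ _ _

variable (S) in
/-- The contravariant defect may be computed in the stable category. -/
noncomputable def contraDefectIso : S.contraDefect ≅ S.stableDefect ⋙ S.resStable :=
  NatIso.ofComponents contraDefectObjIso (fun {U V} p => by
    rw [← cancel_epi (contraDefectπ U), ← Category.assoc, contraDefectπ_map, Category.assoc,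
      contraDefectπ_objIso, map_comp_toStableDefect, ← contraDefectπ_objIso, Category.assoc,
      Functor.comp_map])

variable (S) in
/-- The covariant defect may be computed in the costable category. -/
noncomputable def coDefectIso : S.coDefect ≅ S.costableDefect ⋙ S.resCostable :=
  NatIso.ofComponents (fun U => coDefectObjIso U.unop) (fun {V U} p => by
    -- Naturality is proved for `p.unop.op`, the form in which the lemmas apply; it is
    -- definitionally `p`.
    have h : S.coDefect.map p.unop.op ≫ (coDefectObjIso U.unop).hom =
        (coDefectObjIso V.unop).hom ≫ S.resCostable.map (S.costableDefect.map p.unop.op) := by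
      rw [← cancel_epi (coDefectπ V.unop), ← Category.assoc, coDefectπ_map, Category.assoc,
        coDefectπ_objIso, map_comp_toCostableDefect, ← coDefectπ_objIso, Category.assoc]
    exact h)

end NExangulated

/-! ### Exangles whose defects are extension functors or representable functors. -/

namespace NExangulated

variable {C : Type u} [Category.{v} C] [Preadditive C] [HasZeroObject C]
  [HasBinaryBiproducts C] {n : ℕ} (S : NExangulated C n)

/-- The transformation `C(-, B) ⟶ E(-, A)` given by an extension `δ ∈ E(B, A)`. -/
def yonedaToExt {A B : C} (δ : (S.E.obj (op B)).obj A) :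
    preadditiveYoneda.obj B ⟶ S.E.flip.obj A where
  app T := AddCommGrpCat.ofHom
    (AddMonoidHom.mk' (fun c : T.unop ⟶ B => extPull S.E c δ) fun c c' => S.add_extPull c c' δ)
  naturality T T' f := by
    ext c
    exact extPull_comp S.E f.unop c δ

/-- The transformation `C(A, -) ⟶ E(B, -)` given by an extension `δ ∈ E(B, A)`. -/
def coyonedaToExt {A B : C} (δ : (S.E.obj (op B)).obj A) :
    preadditiveCoyoneda.obj (op A) ⟶ S.E.obj (op B) where
  app T := AddCommGrpCat.ofHom
    (AddMonoidHom.mk' (fun a : A ⟶ T => extPush S.E a δ) fun a a' => S.add_extPush a a' δ)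
  naturality T T' f := by
    ext a
    exact extPush_comp S.E a f δ

variable {S}

/-- If every extension of the first term is killed by the first differential, then the
contravariant defect is `E(-, X⁰)`. -/
theorem nonempty_contraDefect_iso (hn : 1 ≤ n) (U : S.DistExangle)
    (hU : ∀ (T : C) (θ : (S.E.obj (op T)).obj U.A), extPush S.E U.X.first θ = 0) :
    Nonempty (S.contraDefect.obj U ≅ S.E.flip.obj U.A) := by
  have w : preadditiveYoneda.map U.X.last ≫ S.yonedaToExt U.δ = 0 := by
    apply preadditiveYoneda_hom_ext
    exact ((S.isExangle _ _ U.realizes).exact_left_end _ _).2 ⟨𝟙 _, rfl⟩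
  exact ⟨cokernelDescIso (preadditiveYoneda.map U.X.last) (S.yonedaToExt U.δ) w
    -- The defect always embeds in `E(-, X⁰)`; `hU` makes the embedding onto, by exactness at `E(T,
    -- X⁰)`.
    (fun T θ => exists_extPull_eq hn U.realizes (T := T.unop) θ (hU _ θ))
    (fun T x hx => ((S.isExangle _ _ U.realizes).exact_left_end T.unop x).1 hx)⟩

/-- If every extension by the last term is killed by the last differential, then the
covariant defect is `E(Xⁿ⁺¹, -)`. -/
theorem nonempty_coDefect_iso (hn : 1 ≤ n) (U : S.DistExangle)
    (hU : ∀ (T : C) (θ : (S.E.obj (op U.B)).obj T), extPull S.E U.X.last θ = 0) :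
    Nonempty (S.coDefect.obj (op U) ≅ S.E.obj (op U.B)) := by
  have w : preadditiveCoyoneda.map U.X.first.op ≫ S.coyonedaToExt U.δ = 0 := by
    apply preadditiveCoyoneda_hom_ext
    exact ((S.isExangle _ _ U.realizes).exact_right_end _ _).2 ⟨𝟙 _, rfl⟩
  exact ⟨cokernelDescIso (preadditiveCoyoneda.map U.X.first.op) (S.coyonedaToExt U.δ) w
    (fun T θ => exists_extPush_eq hn U.realizes (T := T) θ (hU _ θ))
    (fun T x hx => ((S.isExangle _ _ U.realizes).exact_right_end T x).1 hx)⟩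

/-- If the last differential vanishes in the stable category, then the contravariant defect is
representable over it. -/
theorem nonempty_stableDefect_iso (U : S.DistExangle) (hU : S.toStable.map U.X.last = 0) :
    Nonempty (S.stableDefect.obj U ≅ reprRight (S.toStable.obj U.B)) := by
  have h : preadditiveYoneda.map (S.toStable.map U.X.last) = 0 := by
    rw [hU, preadditiveYoneda_map_zero]
  exact ⟨ObjectProperty.isoMk _ (cokernelIsoOfEq h ≪≫ cokernelZeroIsoTarget)⟩

/-- If the first differential vanishes in the costable category, then the covariant defect is
representable over it. -/
theorem nonempty_costableDefect_iso (U : S.DistExangle) (hU : S.toCostable.map U.X.first = 0) :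
    Nonempty (S.costableDefect.obj (op U) ≅ reprLeft (S.toCostable.obj U.A)) := by
  have h : preadditiveCoyoneda.map (S.toCostable.map U.X.first).op = 0 := by
    rw [hU, preadditiveCoyoneda_map_zero]
  exact ⟨ObjectProperty.isoMk _ (cokernelIsoOfEq h ≪≫ cokernelZeroIsoTarget)⟩

end NExangulated

/-! ### The duality and its values on representable and extension functors. -/

theorem proposition3p7 {C : Type u} [Category.{v} C] [Preadditive C] [HasZeroObject C]
    [HasBinaryBiproducts C] {n : ℕ} (hn : 1 ≤ n) (S : NExangulated C n)
    (hP : S.EnoughProj) (hI : S.EnoughInj) :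
    ∃ Sig : (ModRight S.Stable)ᵒᵖ ≌ ModLeft S.Costable,
      (∃ Θ : S.DistExangle ⥤ ModRight S.Stable,
        Nonempty (Θ ⋙ S.resStable ≅ S.contraDefect) ∧
        Nonempty (Θ.op ⋙ Sig.functor ⋙ S.resCostable ≅ S.coDefect)) ∧
      (∀ X : C, Nonempty
        (S.resCostable.obj (Sig.functor.obj (op (reprRight (S.toStable.obj X)))) ≅
          S.E.obj (op X))) ∧
      (∀ X : C, ∃ F : ModRight S.Stable,
        Nonempty (S.resStable.obj F ≅ S.E.flip.obj X) ∧
        Nonempty (Sig.functor.obj (op F) ≅ reprLeft (S.toCostable.obj X))) := by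
  have := NExangulated.stableDefect_full (S := S) hn
  have := NExangulated.stableDefect_essSurj hn hP
  have := NExangulated.costableDefect_full (S := S) hn
  have := NExangulated.costableDefect_essSurj hn hI
  have hrel : ∀ ⦃U V : S.DistExangleᵒᵖ⦄ (p q : U ⟶ V),
      S.stableDefect.op.map p = S.stableDefect.op.map q ↔
        S.costableDefect.map p = S.costableDefect.map q := by
    intro U V p q
    refine Iff.trans ?_ (NExangulated.costableDefect_map_eq_iff p.unop q.unop).symm
    -- Compatibility of `p` and `q` with the extensions turns equality of push-forwards into
    -- equality of pull-backs.
    rw [p.unop.comm, q.unop.comm, ← NExangulated.stableDefect_map_eq_iff]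
    exact Quiver.Hom.op_inj.eq_iff
  obtain ⟨Sig, ⟨α⟩⟩ :=
    exists_equivalence_of_homRel_eq S.stableDefect.op S.costableDefect hrel
  refine ⟨Sig, ⟨S.stableDefect, ⟨S.contraDefectIso.symm⟩,
    ⟨Functor.isoWhiskerRight α S.resCostable ≪≫ S.coDefectIso.symm⟩⟩, fun X => ?_, fun X => ?_⟩
  -- With `Kⁿ` projective, the last differential vanishes stably, so the contravariant defect is
  -- representable; extensions by `Kⁿ` vanish, so the covariant defect is all of `E(X, -)`.
  · obtain ⟨A, δ, K, hK, hproj⟩ := hP X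
    let U : S.DistExangle := ⟨A, X, δ, K, hK⟩
    obtain ⟨i⟩ := NExangulated.nonempty_stableDefect_iso U
      (by
        rw [← Category.id_comp U.X.last, Functor.map_comp,
          idealQuotient_map_eq_zero_of_target S.proj (hproj n hn le_rfl), zero_comp])
    obtain ⟨j⟩ := NExangulated.nonempty_coDefect_iso hn U
      (fun T θ => NExangulated.eq_zero_of_proj (hproj n hn le_rfl) _)
    exact ⟨S.resCostable.mapIso (Sig.functor.mapIso i.op ≪≫ α.app (op U)) ≪≫
      S.coDefectIso.symm.app (op U) ≪≫ j⟩
  -- Dually, with `K¹` injective the covariant defect is representable and the contravariant one is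
  -- `E(-, X)`, so the latter is finitely presented over the stable category.
  · obtain ⟨B, δ, K, hK, hinj⟩ := hI X
    let U : S.DistExangle := ⟨X, B, δ, K, hK⟩
    obtain ⟨i⟩ := NExangulated.nonempty_costableDefect_iso U
      (idealQuotient_map_eq_zero_of_target S.inj (hinj 1 le_rfl hn) _)
    obtain ⟨j⟩ := NExangulated.nonempty_contraDefect_iso hn U
      (fun T θ => NExangulated.eq_zero_of_inj (hinj 1 le_rfl hn) _)
    exact ⟨S.stableDefect.obj U, ⟨S.contraDefectIso.symm.app U ≪≫ j⟩, ⟨α.app (op U) ≪≫ i⟩⟩
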